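/- Let $\Im\tau>0$, $q=e^{2\pi i\tau}$, $q^{r}:=e^{2\pi i r\tau}$ for real $r$, and $(a;q)_\infty=\prod_{k\ge 0}(1-aq^k)$. Let $$\theta_1(z|\tau)=2q^{1/8}\sum_{n=0}^\infty(-1)^nq^{n(n+1)/2}\sin((2n+1)z),\qquad \theta_2(z|\tau)=2q^{1/8}\sum_{n=0}^\infty q^{n(n+1)/2}\cos((2n+1)z),$$ let $\left(\frac{\cdot}{n}\right)$ denote the Kronecker symbol, and let $\chi_8(n)=\left(\frac{8}{n}\right)$, i.e. $\chi_8(n)=1$ if $n\equiv\pm1$, $\chi_8(n)=-1$ if $n\equiv\pm3 \pmod 8$, and $\chi_8(n)=0$ if $n$ is even. For every complex $z$ with $|\Im z|<\pi\,\Im\tau$ and $\cos 4z\neq0$, the series below converges absolutely, $\theta_2(4z|4\tau)\ne 0$, and $$\frac{\sin 2z}{\cos 4z}-2\sum_{n=1}^\infty\chi_8(n)\frac{q^n}{1-q^n}\sin 2nz=q^{3/8}\,\frac{(q^4;q^4)_\infty^2(q^2;q^2)_\infty}{(q;q)_\infty}\,\frac{\theta_1(2z|\tau)}{\theta_2(4z|4\tau)}.$$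 Moreover, all the following series converge absolutely, and $$1-2\sum_{n=1}^\infty\chi_8(n)\frac{nq^n}{1-q^n}=\frac{(q;q)_\infty^2(q^2;q^2)_\infty(q^4;q^4)_\infty^3}{(q^8;q^8)_\infty^2},$$ $$1+\sum_{n=1}^\infty\left(\frac{-24}{n}\right)\frac{q^n}{1-q^n}=\frac{(q^2;q^2)_\infty(q^3;q^3)_\infty(q^8;q^8)_\infty(q^{12};q^{12})_\infty}{(q;q)_\infty(q^{24};q^{24})_\infty},$$ $$1+2\sum_{n=1}^\infty\left(\frac{-32}{n}\right)\frac{q^n}{1-q^n}=\frac{(q^2;q^2)_\infty^3(q^4;q^4)_\infty^3}{(q;q)_\infty^2(q^8;q^8)_\infty^2}.$$ -/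

import Mathlib

open Complex

namespace EvenCharacterLambert

noncomputable section

/-- `q = exp(2πiτ)`. -/
def nome (τ : ℂ) : ℂ := cexp (2 * (Real.pi : ℂ) * I * τ)

/-- The power `q ^ r = exp(2πi r τ)` of `q = exp(2πiτ)`, for a real exponent `r`. -/
def nomePow (τ : ℂ) (r : ℝ) : ℂ := cexp (2 * (Real.pi : ℂ) * I * (r : ℂ) * τ)

/-- The infinite `q`-shifted factorial `(a;q)_∞ = ∏_{k ≥ 0} (1 - a q^k)` (for `|q| < 1`). -/
def qPochInf (a q : ℂ) : ℂ := ∏' k : ℕ, (1 - a * q ^ k)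

/-- The infinite product `(q^m; q^m)_∞` with `q = exp(2πiτ)`. -/
def eulerProd (m : ℕ) (τ : ℂ) : ℂ := qPochInf (nome τ ^ m) (nome τ ^ m)

/-- The Jacobi theta function
`θ₁(z|τ) = 2 q^{1/8} ∑_{n ≥ 0} (-1)^n q^{n(n+1)/2} sin((2n+1)z)`.
(The division `n(n+1)/2` in the exponent is exact.) -/
def theta1 (z τ : ℂ) : ℂ :=
  2 * nomePow τ (1 / 8) *
    ∑' n : ℕ, (-1 : ℂ) ^ n * nome τ ^ (n * (n + 1) / 2) * Complex.sin ((2 * (n : ℂ) + 1) * z)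

/-- The Jacobi theta function
`θ₂(z|τ) = 2 q^{1/8} ∑_{n ≥ 0} q^{n(n+1)/2} cos((2n+1)z)`. -/
def theta2 (z τ : ℂ) : ℂ :=
  2 * nomePow τ (1 / 8) *
    ∑' n : ℕ, nome τ ^ (n * (n + 1) / 2) * Complex.cos ((2 * (n : ℂ) + 1) * z)

/-- The Kronecker symbol `(a/n)` for an integer `a` and a natural number `n`: the completely
multiplicative extension in `n` of the Legendre symbol, with `(a/2) = 0, 1, -1` according as
`a` is even, `a ≡ ±1 (mod 8)`, `a ≡ ±3 (mod 8)`; this is the value `χ₈(a)`. -/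
def kronecker (a : ℤ) (n : ℕ) : ℤ :=
  if n = 0 then (if a.natAbs = 1 then 1 else 0)
  else (n.primeFactorsList.map fun p => if p = 2 then ZMod.χ₈ (a : ZMod 8) else jacobiSym a p).prod

/-- The even Dirichlet character `χ₈(n) = (8/n)` modulo 8. -/
def chi8 (n : ℕ) : ℤ := kronecker 8 n

end

end EvenCharacterLambert

namespace EvenCharacterLambert

open Filter Topology

/-! With `x = exp(2iz)` and f(y) = Σ χ₈(n)yⁿ = y(1 - y²)/(1 + y⁴), expanding in geometric series
turns the left side into I · Σ_{k∈ℤ} f(qᵏx); negative k enter through f(1/y) = -f(y)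
(`exists_hasSum_bilateral`). The strip is exactly where |q||x| and |q|/|x| are below 1.

The bilateral sum is evaluated without function theory. Put Θ(y) = Σ q^{2n(n+1)} yⁿ, a product by
Jacobi's triple product. It vanishes at y = -1, so Θ(y)/(1+y) has a Laurent expansion Σ bₙyⁿ on the
whole punctured plane. Quasi-periodicity of Θ under y ↦ q⁴y turns Θ(x⁴)/(1 + (qᵏx)⁴) into a multiple
of that expansion at q^{4k}x⁴. In the resulting double sum over (k, n), completing the square with N
= k + n separates the variables (`hasSum_double`): each of the two monomials of y(1 - y²) gives a
constant times a theta series in x⁴. The symmetry of bₙ makes both constants multiples of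
`quotConst`, and the two theta series are the odd and even halves of the series for θ₁
(`thetaSum_sub_thetaSum`). So Θ(x⁴) · Σ f(qᵏx) is a constant times the θ₁ product, and
`quotConst_mul` finds the constant at x⁴ = -1, where only k = 0 survives.

The three Lambert series are the cases z → 0 (after division by sin 2z), z = π/3 and z = π/4: there
sin 2nz becomes n, (√3/2)(n/3) and χ₄(n), and the theta quotient collapses to Euler products. -/

theorem hasSum_of_eq {ι : Type*} {f g : ι → ℂ} {a b : ℂ} (h : HasSum f a) (hf : ∀ i, g i = f i)
    (hab : b = a) : HasSum g b := by
  rw [hab, funext hf]; exact h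

/-- The finite product `(q;q)_n`. -/
noncomputable def qFact (q : ℂ) (n : ℕ) : ℂ := ∏ k ∈ Finset.range n, (1 - q ^ (k + 1))

/-- `1 / (q;q)_m`, extended by zero to negative `m`. -/
noncomputable def invQFact (q : ℂ) (m : ℤ) : ℂ := if 0 ≤ m then (qFact q m.toNat)⁻¹ else 0

/-! ### Convergence and nonvanishing of q-shifted factorials -/

theorem one_sub_pow_ne_zero {q : ℂ} (hq : ‖q‖ < 1) {n : ℕ} (hn : n ≠ 0) : 1 - q ^ n ≠ 0 := by
  intro h
  have h1 : ‖q ^ n‖ < 1 := by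
    rw [norm_pow]; exact pow_lt_one₀ (norm_nonneg _) hq hn
  rw [← sub_eq_zero.mp h] at h1
  simp at h1

theorem qFact_ne_zero {q : ℂ} (hq : ‖q‖ < 1) (n : ℕ) : qFact q n ≠ 0 :=
  Finset.prod_ne_zero_iff.mpr fun k _ => one_sub_pow_ne_zero hq k.succ_ne_zero

/-- Extension by zero is the right convention: at m = 0 the factor 1 - q⁰ vanishes, so the
recurrence holds for every integer m. -/
theorem invQFact_sub_one {q : ℂ} (hq : ‖q‖ < 1) (m : ℤ) :
    invQFact q (m - 1) = (1 - q ^ m) * invQFact q m := by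
  rcases lt_trichotomy m 0 with h | rfl | h
  · rw [invQFact, invQFact, if_neg (by omega), if_neg (by omega), mul_zero]
  · simp [invQFact]
  · obtain ⟨n, rfl⟩ : ∃ n : ℕ, m = n + 1 := ⟨(m - 1).toNat, by omega⟩
    have h1 := one_sub_pow_ne_zero hq n.succ_ne_zero
    have h2 := qFact_ne_zero hq n
    rw [invQFact, invQFact, if_pos (by omega), if_pos (by omega)]
    have e1 : ((n : ℤ) + 1 - 1).toNat = n := by omega
    have e2 : ((n : ℤ) + 1).toNat = n + 1 := by omega
    rw [e1, e2, qFact, qFact, Finset.prod_range_succ]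
    rw [qFact] at h2
    have e3 : q ^ ((n : ℤ) + 1) = q ^ (n + 1) := by exact_mod_cast rfl
    rw [e3]
    field_simp

theorem summable_norm_mul_pow {q : ℂ} (hq : ‖q‖ < 1) (a : ℂ) :
    Summable fun k : ℕ => ‖-(a * q ^ k)‖ := by
  simp only [norm_neg, norm_mul, norm_pow]
  exact (summable_geometric_of_lt_one (norm_nonneg _) hq).mul_left _

theorem multipliable_qPoch {q : ℂ} (hq : ‖q‖ < 1) (a : ℂ) :
    Multipliable fun k : ℕ => (1 - a * q ^ k) := by
  simp_rw [sub_eq_add_neg]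
  exact multipliable_one_add_of_summable (summable_norm_mul_pow hq a)

theorem qPochInf_ne_zero {q : ℂ} (hq : ‖q‖ < 1) {a : ℂ} (ha : ∀ k : ℕ, a * q ^ k ≠ 1) :
    qPochInf a q ≠ 0 := by
  have := tprod_one_add_ne_zero_of_summable (f := fun k : ℕ => -(a * q ^ k))
    (fun k => by rw [← sub_eq_add_neg]; exact sub_ne_zero.mpr (ha k).symm)
    (summable_norm_mul_pow hq a)
  simpa only [qPochInf, sub_eq_add_neg] using this

theorem qPochInf_ne_zero_of_norm_lt {q : ℂ} (hq : ‖q‖ < 1) {a : ℂ} (ha : ‖a‖ < 1) :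
    qPochInf a q ≠ 0 := by
  refine qPochInf_ne_zero hq fun k h => ?_
  have h1 : ‖a * q ^ k‖ < 1 := by
    rw [norm_mul, norm_pow]
    exact lt_of_le_of_lt (mul_le_of_le_one_right (norm_nonneg _)
      (pow_le_one₀ (norm_nonneg _) hq.le)) ha
  rw [h] at h1
  simp at h1

theorem tendsto_qPoch {q : ℂ} (hq : ‖q‖ < 1) (a : ℂ) :
    Tendsto (fun n => ∏ k ∈ Finset.range n, (1 - a * q ^ k)) atTop (𝓝 (qPochInf a q)) :=
  (multipliable_qPoch hq a).tendsto_prod_tprod_nat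

theorem tendsto_qFact {q : ℂ} (hq : ‖q‖ < 1) :
    Tendsto (qFact q) atTop (𝓝 (qPochInf q q)) := by
  refine (tendsto_qPoch hq q).congr fun n => ?_
  exact Finset.prod_congr rfl fun k _ => by rw [pow_succ']

theorem tendsto_invQFact {q : ℂ} (hq : ‖q‖ < 1) :
    Tendsto (invQFact q) atTop (𝓝 (qPochInf q q)⁻¹) := by
  have h := ((tendsto_qFact hq).inv₀ (qPochInf_ne_zero_of_norm_lt hq hq)).comp
    (tendsto_atTop_atTop.mpr fun b => ⟨(b : ℤ), fun a ha => by omega⟩ :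
      Tendsto Int.toNat atTop atTop)
  refine h.congr' ?_
  filter_upwards [eventually_ge_atTop 0] with m hm
  simp [invQFact, hm]

theorem exists_norm_invQFact_le {q : ℂ} (hq : ‖q‖ < 1) : ∃ C, ∀ m, ‖invQFact q m‖ ≤ C := by
  have h := ((tendsto_qFact hq).inv₀ (qPochInf_ne_zero_of_norm_lt hq hq)).norm
  obtain ⟨C, hC⟩ := h.bddAbove_range
  refine ⟨C, fun m => ?_⟩
  have hC' := fun n : ℕ => hC ⟨n, rfl⟩
  rw [invQFact]
  split_ifs
  · exact hC' _
  · rw [norm_zero]; exact (norm_nonneg _).trans (hC' 0)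

/-! ### Jacobi triple product, with base q = s² so that q^{i(i-1)/2} is an integral power of s -/

theorem summable_zpow_sq_mul_zpow {s v : ℂ} (hs0 : s ≠ 0) (hs : ‖s‖ < 1) (hv : v ≠ 0) :
    Summable fun n : ℤ => s ^ (n ^ 2) * v ^ n := by
  have hpi : (Real.pi : ℂ) ≠ 0 := by exact_mod_cast Real.pi_ne_zero
  have h := (summable_jacobiTheta₂_term_iff (log v / (2 * Real.pi * I))
    (log s / (Real.pi * I))).mpr (by
      have : (log s / (Real.pi * I)) = ((-1 / Real.pi : ℝ) : ℂ) * (log s * I) := by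
        push_cast
        field_simp
        rw [I_sq]; ring
      rw [this, im_ofReal_mul, mul_I_im, log_re]
      exact mul_pos_of_neg_of_neg (div_neg_of_neg_of_pos (by norm_num) Real.pi_pos)
        (Real.log_neg (norm_pos_iff.mpr hs0) hs))
  refine h.congr fun n => ?_
  rw [jacobiTheta₂_term]
  have : 2 * Real.pi * I * n * (log v / (2 * Real.pi * I)) + Real.pi * I * n ^ 2 *
      (log s / (Real.pi * I)) = ((n ^ 2 : ℤ) : ℂ) * log s + n * log v := by
    push_cast
    field_simp
    ring
  rw [this, exp_add, exp_int_mul, exp_int_mul, exp_log hs0, exp_log hv]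

theorem summable_zpow_mul_sub_one {s v : ℂ} (hs0 : s ≠ 0) (hs : ‖s‖ < 1) (hv : v ≠ 0) :
    Summable fun n : ℤ => s ^ (n * (n - 1)) * v ^ n := by
  refine (summable_zpow_sq_mul_zpow hs0 hs (div_ne_zero hv hs0)).congr fun n => ?_
  rw [div_zpow, show n * (n - 1) = n ^ 2 - n by ring, zpow_sub₀ hs0]
  ring

/-- The finite form of the Jacobi triple product. -/
theorem hasSum_finite_triple_product {s v : ℂ} (hs0 : s ≠ 0) (hs : ‖s‖ < 1) (hv : v ≠ 0) (n : ℕ) :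
    HasSum (fun i : ℤ => qFact (s ^ 2) (2 * n) * (invQFact (s ^ 2) (n + i) *
      invQFact (s ^ 2) (n - i)) * (s ^ (i * (i - 1)) * v ^ i))
      ((∏ k ∈ Finset.range n, (1 - -v * (s ^ 2) ^ k)) *
        ∏ k ∈ Finset.range n, (1 - -(s ^ 2 / v) * (s ^ 2) ^ k)) := by
  have hq : ‖s ^ 2‖ < 1 := by rw [norm_pow]; exact pow_lt_one₀ (norm_nonneg _) hs two_ne_zero
  have hq0 : s ^ 2 ≠ 0 := pow_ne_zero _ hs0
  induction n with
  | zero =>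
    convert hasSum_single (0 : ℤ) _ using 1
    · simp [qFact, invQFact]
    · intro i hi
      rcases lt_or_gt_of_ne hi with h | h
      · simp [invQFact, h.not_ge]
      · simp [invQFact, h.not_ge]
  | succ n ih =>
    -- The new factor is (1 + vqⁿ)(1 + q^{n+1}/v) = (1 + q^{2n+1}) + vqⁿ + v⁻¹q^{n+1} with q = s²;
    -- the last two terms shift the summation index by ∓1.
    have h1 := ih.mul_left (1 + s ^ 2 * (s ^ 2) ^ (2 * n))
    have h2 := ((Equiv.subRight (1 : ℤ)).hasSum_iff.mpr ih).mul_left (v * (s ^ 2) ^ n)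
    have h3 := ((Equiv.addRight (1 : ℤ)).hasSum_iff.mpr ih).mul_left (v⁻¹ * (s ^ 2) ^ (n + 1))
    refine hasSum_of_eq ((h1.add h2).add h3) (fun i => ?_) ?_
    · simp only [Function.comp, Equiv.subRight_apply, Equiv.coe_addRight]
      have a1 := invQFact_sub_one hq (n + 1 + i)
      have a2 := invQFact_sub_one hq (n + i)
      have b1 := invQFact_sub_one hq (n + 1 - i)
      have b2 := invQFact_sub_one hq (n - i)
      rw [show (n : ℤ) + 1 + i - 1 = n + i by ring] at a1
      rw [show (n : ℤ) + 1 - i - 1 = n - i by ring] at b1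
      rw [a1] at a2
      rw [b1] at b2
      rw [show (n : ℤ) + (i - 1) = n + i - 1 by ring, show (n : ℤ) - (i - 1) = n + 1 - i by ring,
        show (n : ℤ) + (i + 1) = n + 1 + i by ring, show (n : ℤ) - (i + 1) = n - i - 1 by ring,
        a1, a2, b1, b2]
      have e0 : s ^ (2 * i) = (s ^ 2) ^ i := by rw [zpow_mul]; rfl
      have e1 : s ^ ((i - 1) * (i - 1 - 1)) = s ^ (i * (i - 1)) * s ^ 2 / (s ^ 2) ^ i := by
        rw [show (i - 1) * (i - 1 - 1) = i * (i - 1) + 2 - 2 * i by ring, zpow_sub₀ hs0,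
          zpow_add₀ hs0, e0]
        rfl
      have e2 : s ^ ((i + 1) * (i + 1 - 1)) = s ^ (i * (i - 1)) * (s ^ 2) ^ i := by
        rw [show (i + 1) * (i + 1 - 1) = i * (i - 1) + 2 * i by ring, zpow_add₀ hs0, e0]
      have e3 : qFact (s ^ 2) (2 * (n + 1)) = qFact (s ^ 2) (2 * n) *
          (1 - s ^ 2 * ((s ^ 2) ^ n) ^ 2) * (1 - (s ^ 2) ^ 2 * ((s ^ 2) ^ n) ^ 2) := by
        rw [qFact, qFact, show 2 * (n + 1) = 2 * n + 1 + 1 by ring, Finset.prod_range_succ,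
          Finset.prod_range_succ]
        ring
      rw [e1, e2, e3, zpow_sub₀ hv, zpow_add₀ hv]
      push_cast
      have hn : ((n : ℤ) + 1) = ((n + 1 : ℕ) : ℤ) := by push_cast; ring
      simp only [zpow_add₀ hq0, zpow_sub₀ hq0, zpow_one, zpow_natCast]
      generalize invQFact (s ^ 2) (n + 1 + i) = a
      generalize invQFact (s ^ 2) (n + 1 - i) = b
      generalize s ^ (i * (i - 1)) = c
      generalize qFact (s ^ 2) (2 * n) = d
      have hy : (s ^ 2) ^ i ≠ 0 := zpow_ne_zero _ hq0
      revert hy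
      generalize (s ^ 2) ^ i = Y
      intro hy
      rw [pow_succ (s ^ 2) n, pow_mul' (s ^ 2) 2 n]
      generalize (s ^ 2) ^ n = X
      field_simp
      ring
    · rw [Finset.prod_range_succ, Finset.prod_range_succ]
      rw [pow_mul']
      field_simp
      ring

/-- The Jacobi triple product identity. -/
theorem hasSum_triple_product {s v : ℂ} (hs0 : s ≠ 0) (hs : ‖s‖ < 1) (hv : v ≠ 0) :
    HasSum (fun i : ℤ => s ^ (i * (i - 1)) * v ^ i)
      (qPochInf (s ^ 2) (s ^ 2) * (qPochInf (-v) (s ^ 2) * qPochInf (-(s ^ 2 / v)) (s ^ 2))) := by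
  have hq : ‖s ^ 2‖ < 1 := by rw [norm_pow]; exact pow_lt_one₀ (norm_nonneg _) hs two_ne_zero
  have hsum := summable_zpow_mul_sub_one hs0 hs hv
  have hne := qPochInf_ne_zero_of_norm_lt hq hq
  obtain ⟨C, hC⟩ := exists_norm_invQFact_le hq
  obtain ⟨D, hD⟩ := (tendsto_qFact hq).norm.bddAbove_range
  have hD' : ∀ n, ‖qFact (s ^ 2) n‖ ≤ D := fun n => hD ⟨n, rfl⟩
  -- Tannery's theorem: the q-factorial quotients are bounded uniformly in n and i and tend to
  -- 1/(s²;s²)_∞.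
  have hlim := tendsto_tsum_of_dominated_convergence (𝓕 := atTop)
    (f := fun (n : ℕ) (i : ℤ) => qFact (s ^ 2) (2 * n) * (invQFact (s ^ 2) (n + i) *
      invQFact (s ^ 2) (n - i)) * (s ^ (i * (i - 1)) * v ^ i))
    (g := fun i => qPochInf (s ^ 2) (s ^ 2) * ((qPochInf (s ^ 2) (s ^ 2))⁻¹ *
      (qPochInf (s ^ 2) (s ^ 2))⁻¹) * (s ^ (i * (i - 1)) * v ^ i))
    (bound := fun i => D * (C * C) * ‖s ^ (i * (i - 1)) * v ^ i‖)
    (hsum.norm.mul_left _)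
    (fun i => by
      refine Tendsto.mul_const _ (((tendsto_qFact hq).comp ?_).mul
        (((tendsto_invQFact hq).comp ?_).mul ((tendsto_invQFact hq).comp ?_)))
      · exact tendsto_atTop_atTop.mpr fun b => ⟨b, fun a ha => by omega⟩
      · exact tendsto_atTop_atTop.mpr fun b => ⟨(b - i).toNat, fun a ha => by omega⟩
      · exact tendsto_atTop_atTop.mpr fun b => ⟨(b + i).toNat, fun a ha => by omega⟩)
    (Eventually.of_forall fun n i => by
      rw [norm_mul, norm_mul, norm_mul (invQFact _ _)]
      have := hD' (2 * n)
      have := hC (n + i)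
      have := hC (n - i)
      have := (norm_nonneg _).trans (hC 0)
      have := (norm_nonneg _).trans (hD' 0)
      gcongr)
  have hlim2 := (tendsto_qPoch hq (-v)).mul (tendsto_qPoch hq (-(s ^ 2 / v)))
  have heq := tendsto_nhds_unique (hlim.congr fun n =>
    (hasSum_finite_triple_product hs0 hs hv n).tsum_eq) hlim2
  rw [tsum_mul_left] at heq
  rw [← heq]
  convert hsum.hasSum using 1
  field_simp

/-! ### Parity splitting, and continuity and functional equations of (a;q)_∞ -/

theorem HasSum.int_even_add_odd {f : ℤ → ℂ} {a b : ℂ} (he : HasSum (fun k => f (2 * k)) a)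
    (ho : HasSum (fun k => f (2 * k + 1)) b) : HasSum f (a + b) := by
  have h2 := mul_right_injective₀ (two_ne_zero' ℤ)
  replace he := h2.hasSum_range_iff.2 he
  replace ho := ((add_left_injective 1).comp h2).hasSum_range_iff.2 ho
  refine he.add_isCompl ?_ ho
  simpa [Function.comp_def] using Int.isCompl_even_odd

theorem tendsto_qPochInf {α : Type*} {l : Filter α} {φ : α → ℂ} {a q : ℂ} (hq : ‖q‖ < 1)
    (h : Tendsto φ l (𝓝 a)) : Tendsto (fun t => qPochInf (φ t) q) l (𝓝 (qPochInf a q)) := by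
  simp only [qPochInf, sub_eq_add_neg]
  refine tendsto_tprod_one_add_of_dominated_convergence (bound := fun k => (‖a‖ + 1) * ‖q‖ ^ k)
    ((summable_geometric_of_lt_one (norm_nonneg _) hq).mul_left _)
    (fun k => (h.mul_const _).neg) ?_
  filter_upwards [h.norm.eventually_le_const (lt_add_one ‖a‖)] with t ht k
  rw [norm_neg, norm_mul, norm_pow]
  gcongr

theorem qPochInf_eq_mul {q : ℂ} (hq : ‖q‖ < 1) (a : ℂ) :
    qPochInf a q = (1 - a) * qPochInf (a * q) q := by
  refine tendsto_nhds_unique ((tendsto_qPoch hq a).comp (tendsto_add_atTop_nat 1)) ?_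
  refine ((tendsto_qPoch hq (a * q)).const_mul (1 - a)).congr fun n => ?_
  simp only [Function.comp, Finset.prod_range_succ']
  rw [pow_zero, mul_one, mul_comm]
  congr 1
  exact Finset.prod_congr rfl fun k _ => by rw [pow_succ]; ring

theorem qPochInf_mul_neg {q : ℂ} (hq : ‖q‖ < 1) (a : ℂ) :
    qPochInf a q * qPochInf (-a) q = qPochInf (a ^ 2) (q ^ 2) := by
  have hq2 : ‖q ^ 2‖ < 1 := by rw [norm_pow]; exact pow_lt_one₀ (norm_nonneg _) hq two_ne_zero
  refine tendsto_nhds_unique ((tendsto_qPoch hq a).mul (tendsto_qPoch hq (-a))) ?_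
  refine (tendsto_qPoch hq2 (a ^ 2)).congr fun n => ?_
  rw [← Finset.prod_mul_distrib]
  exact Finset.prod_congr rfl fun k _ => by ring

/-- The alternating tail `∑_{i ≥ 0} (-1)^i q^{2(j+i)(j+i+1)}`. -/
noncomputable def altTail (q : ℂ) (j : ℕ) : ℂ :=
  ∑' i : ℕ, (-1) ^ i * q ^ (2 * (j + i) * (j + i + 1))

/-! ### The Laurent expansion of the theta series divided by 1 + y -/

section
variable {q : ℂ}

theorem norm_altTail_term_le (hq : ‖q‖ < 1) (j i : ℕ) :
    ‖(-1) ^ i * q ^ (2 * (j + i) * (j + i + 1))‖ ≤ ‖q‖ ^ (2 * j * (j + 1)) * ‖q‖ ^ i := by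
  rw [norm_mul, norm_pow, norm_neg, norm_one, one_pow, one_mul, norm_pow, ← pow_add]
  exact pow_le_pow_of_le_one (norm_nonneg _) hq.le (by nlinarith [Nat.zero_le (i * i), Nat.zero_le (i * j)])

theorem summable_altTail_bound (hq : ‖q‖ < 1) (j : ℕ) :
    Summable fun i : ℕ => ‖q‖ ^ (2 * j * (j + 1)) * ‖q‖ ^ i :=
  (summable_geometric_of_lt_one (norm_nonneg _) hq).mul_left _

theorem summable_altTail (hq : ‖q‖ < 1) (j : ℕ) :
    Summable fun i : ℕ => (-1) ^ i * q ^ (2 * (j + i) * (j + i + 1)) :=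
  .of_norm_bounded (summable_altTail_bound hq j) (norm_altTail_term_le hq j)

theorem norm_altTail_le (hq : ‖q‖ < 1) (j : ℕ) :
    ‖altTail q j‖ ≤ (1 - ‖q‖)⁻¹ * ‖q‖ ^ (2 * j * (j + 1)) := by
  refine (tsum_of_norm_bounded (summable_altTail_bound hq j).hasSum
    (norm_altTail_term_le hq j)).trans ?_
  rw [tsum_mul_left, tsum_geometric_of_lt_one (norm_nonneg _) hq, mul_comm]

theorem altTail_add (hq : ‖q‖ < 1) (j : ℕ) :
    altTail q j + altTail q (j + 1) = q ^ (2 * j * (j + 1)) := by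
  have h : altTail q j = q ^ (2 * j * (j + 1)) - altTail q (j + 1) := by
    rw [altTail, (summable_altTail hq j).tsum_eq_zero_add, altTail, sub_eq_add_neg, ← tsum_neg]
    congr 1
    · simp
    · exact tsum_congr fun i => by rw [show j + (i + 1) = j + 1 + i by ring]; ring
  rw [h]; ring

/-- The coefficients of the quotient of `∑ q^{2n(n+1)} y^n` by `1 + y`. -/
noncomputable def quotCoeff (q : ℂ) (n : ℤ) : ℂ := altTail q (n + 1).natAbs

theorem quotCoeff_symm (q : ℂ) (n : ℤ) : quotCoeff q (-2 - n) = quotCoeff q n := by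
  rw [quotCoeff, quotCoeff]; congr 1; omega

/-- This is the recurrence for the coefficients of a quotient by 1 + y. One formula in |n + 1|
serves both signs because the exponent 2n(n+1) is invariant under n ↦ -1 - n. -/
theorem quotCoeff_add (hq : ‖q‖ < 1) (n : ℤ) :
    quotCoeff q n + quotCoeff q (n - 1) = q ^ (2 * n * (n + 1)) := by
  rw [quotCoeff, quotCoeff, sub_add_cancel]
  rcases le_or_gt 0 n with h | h
  · obtain ⟨m, rfl⟩ := Int.eq_ofNat_of_zero_le h
    rw [show ((m : ℤ) + 1).natAbs = m + 1 by omega, Int.natAbs_natCast, add_comm, altTail_add hq]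
    exact_mod_cast rfl
  · obtain ⟨m, rfl⟩ : ∃ m : ℕ, n = -(m + 1) := ⟨(-n - 1).toNat, by omega⟩
    rw [show (-((m : ℤ) + 1) + 1).natAbs = m by omega,
      show (-((m : ℤ) + 1)).natAbs = m + 1 by omega, altTail_add hq,
      show 2 * -((m : ℤ) + 1) * (-((m : ℤ) + 1) + 1) = ((2 * m * (m + 1) : ℕ) : ℤ) by
        push_cast; ring, zpow_natCast]

/-- The tail bound is of size |q|^{2j²} to leading order, which cancels the growth of q^{-2j²}; the
linear terms still leave geometric decay in both directions. -/
theorem summable_quotCoeff (hq0 : q ≠ 0) (hq : ‖q‖ < 1) :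
    Summable fun j : ℤ => quotCoeff q j * q ^ (-2 * j ^ 2 - 3 * j) := by
  have hr : 0 < ‖q‖ := norm_pos_iff.mpr hq0
  have hg := (summable_geometric_of_lt_one hr.le hq).mul_left (1 - ‖q‖)⁻¹
  have hC : 0 ≤ (1 - ‖q‖)⁻¹ := inv_nonneg.mpr (by linarith)
  refine Summable.of_nat_of_neg_add_one (.of_norm_bounded hg fun m => ?_)
    (.of_norm_bounded hg fun m => ?_)
  · rw [norm_mul, norm_zpow, quotCoeff, show ((m : ℤ) + 1).natAbs = m + 1 by omega]
    refine (mul_le_mul_of_nonneg_right (norm_altTail_le hq _) (by positivity)).trans ?_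
    rw [mul_assoc, ← zpow_natCast, ← zpow_add₀ hr.ne']
    refine mul_le_mul_of_nonneg_left ?_ hC
    rw [← zpow_natCast]
    exact zpow_le_zpow_right_of_le_one₀ hr hq.le (by push_cast; nlinarith)
  · rw [norm_mul, norm_zpow, quotCoeff, show (-((m : ℤ) + 1) + 1).natAbs = m by omega]
    refine (mul_le_mul_of_nonneg_right (norm_altTail_le hq _) (by positivity)).trans ?_
    rw [mul_assoc, ← zpow_natCast, ← zpow_add₀ hr.ne']
    refine mul_le_mul_of_nonneg_left ?_ hC
    rw [← zpow_natCast]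
    exact zpow_le_zpow_right_of_le_one₀ hr hq.le (by push_cast; nlinarith)

/-- The constant `∑ b_j q^{-2j²-3j}`, where `b` is `quotCoeff q`. -/
noncomputable def quotConst (q : ℂ) : ℂ := ∑' j : ℤ, quotCoeff q j * q ^ (-2 * j ^ 2 - 3 * j)

theorem hasSum_quotCoeff_three (hq0 : q ≠ 0) (hq : ‖q‖ < 1) :
    HasSum (fun j : ℤ => quotCoeff q j * q ^ (-2 * j ^ 2 - 3 * j)) (quotConst q) :=
  (summable_quotCoeff hq0 hq).hasSum

/-- Reflecting j ↦ -2 - j fixes the coefficients and exchanges the linear terms 3j and 5j up to the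
factor q². -/
theorem hasSum_quotCoeff_five (hq0 : q ≠ 0) (hq : ‖q‖ < 1) :
    HasSum (fun j : ℤ => quotCoeff q j * q ^ (-2 * j ^ 2 - 5 * j)) (q ^ 2 * quotConst q) := by
  have h := ((Equiv.subLeft (-2 : ℤ)).hasSum_iff.mpr (hasSum_quotCoeff_three hq0 hq)).mul_left
    (q ^ 2)
  refine hasSum_of_eq h (fun j => ?_) rfl
  simp only [Function.comp, Equiv.subLeft_apply]
  rw [quotCoeff_symm, show -2 * j ^ 2 - 5 * j = 2 + (-2 * (-2 - j) ^ 2 - 3 * (-2 - j)) by ring,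
    zpow_add₀ hq0, show q ^ (2 : ℤ) = q ^ 2 from rfl]
  ring

/-- The theta series `∑ q^{2N²+cN} y^N`. -/
noncomputable def thetaSum (q : ℂ) (c : ℤ) (y : ℂ) : ℂ := ∑' N : ℤ, q ^ (2 * N ^ 2 + c * N) * y ^ N

theorem hasSum_thetaSum (hq0 : q ≠ 0) (hq : ‖q‖ < 1) (c : ℤ) {y : ℂ} (hy : y ≠ 0) :
    HasSum (fun N : ℤ => q ^ (2 * N ^ 2 + c * N) * y ^ N) (thetaSum q c y) := by
  refine Summable.hasSum ((summable_zpow_sq_mul_zpow (s := q ^ 2) (v := q ^ c * y)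
    (pow_ne_zero _ hq0) (by rw [norm_pow]; exact pow_lt_one₀ (norm_nonneg _) hq two_ne_zero)
    (mul_ne_zero (zpow_ne_zero _ hq0) hy)).congr fun N => ?_)
  rw [mul_zpow, ← zpow_mul, zpow_add₀ hq0, zpow_mul q 2, mul_assoc]
  rfl

theorem hasSum_mul_prod {ι κ : Type*} {f : ι → ℂ} {g : κ → ℂ} {a b : ℂ} (hf : HasSum f a)
    (hg : HasSum g b) : HasSum (fun p : ι × κ => f p.1 * g p.2) (a * b) :=
  hf.mul hg (summable_mul_of_summable_norm hf.summable.norm hg.summable.norm)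

/-- The shear `(k, n) ↦ (n, k + n)` of `ℤ × ℤ`. -/
def shearEquiv : ℤ × ℤ ≃ ℤ × ℤ where
  toFun p := (p.2, p.1 + p.2)
  invFun p := (p.2 - p.1, p.1)
  left_inv p := by simp
  right_inv p := by simp

/-- Completing the square, 2k² + 4nk + ck = (-2n² - cn) + (2N² + cN) with N = k + n, so the double
series is a sheared product of two absolutely convergent series. -/
theorem hasSum_double (hq0 : q ≠ 0) (hq : ‖q‖ < 1) {c : ℤ} {S : ℂ}
    (hS : HasSum (fun j : ℤ => quotCoeff q j * q ^ (-2 * j ^ 2 - c * j)) S) {y : ℂ} (hy : y ≠ 0) :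
    HasSum (fun p : ℤ × ℤ => quotCoeff q p.2 *
      q ^ (2 * p.1 ^ 2 + 4 * p.2 * p.1 + c * p.1) * y ^ (p.1 + p.2)) (S * thetaSum q c y) := by
  have hT := hasSum_thetaSum hq0 hq c hy
  refine hasSum_of_eq (shearEquiv.hasSum_iff.mpr (hasSum_mul_prod hS hT)) (fun p => ?_) rfl
  simp only [Function.comp, shearEquiv, Equiv.coe_fn_mk]
  rw [show 2 * p.1 ^ 2 + 4 * p.2 * p.1 + c * p.1 = (-2 * p.2 ^ 2 - c * p.2) +
    (2 * (p.1 + p.2) ^ 2 + c * (p.1 + p.2)) by ring, zpow_add₀ hq0]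
  ring

/-- The Laurent series with coefficients `quotCoeff q`. -/
noncomputable def quotSeries (q y : ℂ) : ℂ := ∑' n : ℤ, quotCoeff q n * y ^ n

theorem hasSum_quotSeries (hq0 : q ≠ 0) (hq : ‖q‖ < 1) {y : ℂ} (hy : y ≠ 0) :
    HasSum (fun n : ℤ => quotCoeff q n * y ^ n) (quotSeries q y) := by
  -- The fibre k = 0 of the double series is the Laurent series itself.
  have h := (hasSum_double hq0 hq (hasSum_quotCoeff_three hq0 hq) hy).summable.prod_factor 0
  refine Summable.hasSum (h.congr fun n => ?_)
  simp

/-- The separated double series, summed over n first. -/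
theorem hasSum_quotSeries_shift (hq0 : q ≠ 0) (hq : ‖q‖ < 1) {c : ℤ} {S : ℂ}
    (hS : HasSum (fun j : ℤ => quotCoeff q j * q ^ (-2 * j ^ 2 - c * j)) S) {y : ℂ} (hy : y ≠ 0) :
    HasSum (fun k : ℤ => q ^ (2 * k ^ 2 + c * k) * y ^ k * quotSeries q (q ^ (4 * k) * y))
      (S * thetaSum q c y) := by
  refine (hasSum_double hq0 hq hS hy).prod_fiberwise fun k => ?_
  refine hasSum_of_eq ((hasSum_quotSeries hq0 hq
    (mul_ne_zero (zpow_ne_zero (4 * k) hq0) hy)).mul_left _) (fun n => ?_) rfl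
  dsimp only
  rw [mul_zpow, ← zpow_mul, zpow_add₀ hy, show 2 * k ^ 2 + 4 * n * k + c * k =
    (2 * k ^ 2 + c * k) + 4 * k * n by ring, zpow_add₀ hq0]
  ring

/-- The product side of `∑ q^{2n(n+1)} y^n`. -/
noncomputable def thetaProd (q y : ℂ) : ℂ :=
  qPochInf (q ^ 4) (q ^ 4) * (qPochInf (-y⁻¹) (q ^ 4) * qPochInf (-(q ^ 4 * y)) (q ^ 4))

theorem hasSum_thetaProd (hq0 : q ≠ 0) (hq : ‖q‖ < 1) {y : ℂ} (hy : y ≠ 0) :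
    HasSum (fun n : ℤ => q ^ (2 * n * (n + 1)) * y ^ n) (thetaProd q y) := by
  have h := hasSum_triple_product (s := q ^ 2) (v := y⁻¹) (pow_ne_zero _ hq0)
    (by rw [norm_pow]; exact pow_lt_one₀ (norm_nonneg _) hq two_ne_zero) (inv_ne_zero hy)
  refine hasSum_of_eq ((Equiv.neg ℤ).hasSum_iff.mpr h) (fun n => ?_) ?_
  · simp only [Function.comp, Equiv.neg_apply]
    rw [inv_zpow', neg_neg, show -n * (-n - 1) = n * (n + 1) by ring, mul_assoc, zpow_mul]
    rfl
  · rw [thetaProd, div_inv_eq_mul, ← pow_mul]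

theorem quotSeries_mul (hq0 : q ≠ 0) (hq : ‖q‖ < 1) {y : ℂ} (hy : y ≠ 0) :
    (1 + y) * quotSeries q y = thetaProd q y := by
  have h := hasSum_quotSeries hq0 hq hy
  have h1 := ((Equiv.subRight (1 : ℤ)).hasSum_iff.mpr h).mul_left y
  rw [add_mul, one_mul]
  refine (h.add h1).unique (hasSum_of_eq (hasSum_thetaProd hq0 hq hy) (fun n => ?_) rfl)
  simp only [Function.comp, Equiv.subRight_apply]
  rw [← quotCoeff_add hq, zpow_sub₀ hy, zpow_one]
  field_simp

/-- Quasi-periodicity, read off the series by the index shift n ↦ n + k. -/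
theorem thetaProd_shift (hq0 : q ≠ 0) (hq : ‖q‖ < 1) {y : ℂ} (hy : y ≠ 0) (k : ℤ) :
    q ^ (2 * k ^ 2 + 2 * k) * y ^ k * thetaProd q (q ^ (4 * k) * y) = thetaProd q y := by
  have h := (hasSum_thetaProd hq0 hq (mul_ne_zero (zpow_ne_zero (4 * k) hq0) hy)).mul_left
    (q ^ (2 * k ^ 2 + 2 * k) * y ^ k)
  refine h.unique (hasSum_of_eq ((Equiv.addRight k).hasSum_iff.mpr (hasSum_thetaProd hq0 hq hy))
    (fun n => ?_) rfl)
  simp only [Function.comp, Equiv.coe_addRight]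
  rw [mul_zpow, ← zpow_mul, zpow_add₀ hy, show 2 * (n + k) * (n + k + 1) =
    (2 * k ^ 2 + 2 * k) + (2 * n * (n + 1)) + 4 * k * n by ring, zpow_add₀ hq0 _ (4 * k * n),
    zpow_add₀ hq0 (2 * k ^ 2 + 2 * k)]
  generalize q ^ (2 * k ^ 2 + 2 * k) = a
  ring

/-- The quotient at the removable singularity: let y → -1, where the factor 1 + y⁻¹ = (1 + y)/y of
the product cancels the 1 + y. -/
theorem quotSeries_neg_one (hq0 : q ≠ 0) (hq : ‖q‖ < 1) :
    quotSeries q (-1) = -qPochInf (q ^ 4) (q ^ 4) ^ 3 := by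
  have hq4 : ‖q ^ 4‖ < 1 := by rw [norm_pow]; exact pow_lt_one₀ (norm_nonneg _) hq four_ne_zero
  have hid : Tendsto (fun y : ℂ => y) (𝓝[≠] (-1)) (𝓝 (-1)) := tendsto_nhdsWithin_of_tendsto_nhds tendsto_id
  have hinv : Tendsto (fun y : ℂ => y⁻¹) (𝓝[≠] (-1)) (𝓝 (-1)⁻¹) := hid.inv₀ (by simp)
  have h1 : Tendsto (quotSeries q) (𝓝[≠] (-1)) (𝓝 (quotSeries q (-1))) := by
    -- On 1/2 ≤ |y| ≤ 2 the terms are dominated by those at y = 2 for n ≥ 0 and at y = 1/2 for n <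
    -- 0.
    have hb := ((hasSum_quotSeries hq0 hq (two_ne_zero' ℂ)).summable.norm.add
      (hasSum_quotSeries hq0 hq (y := 2⁻¹) (by norm_num)).summable.norm)
    refine tendsto_tsum_of_dominated_convergence hb (fun n => ?_) ?_
    · exact tendsto_const_nhds.mul (hid.zpow₀ n (Or.inl (by simp)))
    · have hn := hid.norm
      have e1 := hn.eventually_le_const (u := 2) (by norm_num)
      have e2 := hn.eventually_const_le (u := 2⁻¹) (by norm_num)
      filter_upwards [e1, e2] with y hy1 hy2 n
      rw [norm_mul, norm_mul, norm_mul, ← mul_add, norm_zpow, norm_zpow, norm_zpow]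
      refine mul_le_mul_of_nonneg_left ?_ (norm_nonneg _)
      rw [norm_inv, Complex.norm_ofNat]
      rcases le_or_gt 0 n with h | h
      · have : ‖y‖ ^ n ≤ (2 : ℝ) ^ n := zpow_le_zpow_left₀ h (norm_nonneg _) hy1
        have : (0 : ℝ) ≤ 2⁻¹ ^ n := by positivity
        linarith
      · obtain ⟨m, rfl⟩ : ∃ m : ℕ, n = -m := ⟨(-n).toNat, by omega⟩
        have : ‖y‖ ^ (-(m : ℤ)) ≤ (2⁻¹ : ℝ) ^ (-(m : ℤ)) := by
          rw [zpow_neg, zpow_neg, zpow_natCast, zpow_natCast]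
          gcongr
        have : (0 : ℝ) ≤ 2 ^ (-(m : ℤ)) := by positivity
        linarith
  have h2 : Tendsto (fun y => y⁻¹ * qPochInf (q ^ 4) (q ^ 4) *
      (qPochInf (-y⁻¹ * q ^ 4) (q ^ 4) * qPochInf (-(q ^ 4 * y)) (q ^ 4))) (𝓝[≠] (-1))
      (𝓝 ((-1)⁻¹ * qPochInf (q ^ 4) (q ^ 4) * (qPochInf (-(-1)⁻¹ * q ^ 4) (q ^ 4) *
        qPochInf (-(q ^ 4 * (-1))) (q ^ 4)))) :=
    (hinv.mul_const _).mul ((tendsto_qPochInf hq4 (hinv.neg.mul_const _)).mul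
      (tendsto_qPochInf hq4 (hid.const_mul _).neg))
  have h3 := tendsto_nhds_unique (h1.congr' ?_) h2
  · rw [h3, show -(-1 : ℂ)⁻¹ * q ^ 4 = q ^ 4 by norm_num, show -(q ^ 4 * (-1 : ℂ)) = q ^ 4 by ring]
    norm_num
    ring
  · filter_upwards [self_mem_nhdsWithin, hid.eventually_ne (show (-1 : ℂ) ≠ 0 by simp)]
      with y hy hy0
    have hy1 : 1 + y ≠ 0 := fun h => hy (by
      rw [Set.mem_singleton_iff]; exact eq_neg_of_add_eq_zero_right h)
    refine mul_left_cancel₀ hy1 ?_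
    rw [quotSeries_mul hq0 hq hy0, thetaProd, qPochInf_eq_mul hq4 (-y⁻¹)]
    field_simp
    ring

end

/-- The product side of `∑ (-1)^n q^{n(n-1)/2} x^{-2n}`. -/
noncomputable def altThetaProd (q x : ℂ) : ℂ :=
  qPochInf q q * (qPochInf (x ^ 2)⁻¹ q * qPochInf (q * x ^ 2) q)

/-- The sum `∑ χ₈(n) y^n` in closed form. -/
noncomputable def chiSum (y : ℂ) : ℂ := y * (1 - y ^ 2) / (1 + y ^ 4)

/-! ### Evaluation of the bilateral sum of `chiSum` -/

section
variable {q : ℂ}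

theorem hasSum_altThetaProd {s x : ℂ} (hs0 : s ≠ 0) (hs : ‖s‖ < 1) (hx : x ≠ 0) :
    HasSum (fun i : ℤ => s ^ (i * (i - 1)) * (-(x ^ 2)⁻¹) ^ i) (altThetaProd (s ^ 2) x) := by
  refine hasSum_of_eq (hasSum_triple_product hs0 hs (v := -(x ^ 2)⁻¹)
    (neg_ne_zero.mpr (inv_ne_zero (pow_ne_zero _ hx)))) (fun i => rfl) ?_
  rw [altThetaProd, neg_neg, div_neg, neg_neg, div_inv_eq_mul]

/-- In the triple product series of `altThetaProd`, the even indices 2k give the linear term 5N and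
the odd indices 2k + 1 give 3N, with N = -1 - k. -/
theorem thetaSum_sub_thetaSum (hq0 : q ≠ 0) (hq : ‖q‖ < 1) {x : ℂ} (hx : x ≠ 0) :
    x * thetaSum q 3 (x ^ 4) - q ^ 2 * x ^ 3 * thetaSum q 5 (x ^ 4) =
      -altThetaProd q x / (q * x) := by
  obtain ⟨s, rfl⟩ := IsAlgClosed.exists_pow_nat_eq q (n := 2) two_pos
  have hs0 : s ≠ 0 := fun h => hq0 (by simp [h])
  have hs : ‖s‖ < 1 := by
    rw [norm_pow] at hq
    exact (pow_lt_one_iff_of_nonneg (norm_nonneg _) two_ne_zero).mp hq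
  have hx4 : x ^ 4 ≠ 0 := pow_ne_zero _ hx
  have hx2 : x ^ 2 ≠ 0 := pow_ne_zero _ hx
  have h3 := hasSum_thetaSum hq0 hq 3 hx4
  have h5 := hasSum_thetaSum hq0 hq 5 hx4
  have key : ∀ i : ℤ, (-(x ^ 2)⁻¹) ^ (2 * i) = (x ^ 4) ^ (-i) := fun i => by
    rw [zpow_mul, zpow_neg, ← inv_zpow]
    congr 1
    rw [show (-(x ^ 2)⁻¹) ^ (2 : ℤ) = (-(x ^ 2)⁻¹) ^ 2 from rfl]
    field_simp
  have hT := HasSum.int_even_add_odd (f := fun i : ℤ => s ^ (i * (i - 1)) * (-(x ^ 2)⁻¹) ^ i)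
    (hasSum_of_eq ((Equiv.subLeft (-1 : ℤ)).hasSum_iff.mpr (h5.mul_left (s ^ 6 * x ^ 4)))
      (fun k => by
        simp only [Function.comp, Equiv.subLeft_apply]
        rw [key, show -k = (-1 - k) + 1 by ring, zpow_add₀ hx4, zpow_one,
          show 2 * k * (2 * k - 1) = 6 + 2 * (2 * (-1 - k) ^ 2 + 5 * (-1 - k)) by ring,
          zpow_add₀ hs0, zpow_mul]
        norm_cast
        ring) rfl)
    (hasSum_of_eq ((Equiv.subLeft (-1 : ℤ)).hasSum_iff.mpr (h3.mul_left (-(s ^ 2 * x ^ 2))))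
      (fun k => by
        simp only [Function.comp, Equiv.subLeft_apply]
        rw [zpow_add₀ (neg_ne_zero.mpr (inv_ne_zero hx2)), zpow_one, key,
          show -k = (-1 - k) + 1 by ring, zpow_add₀ hx4, zpow_one,
          show (2 * k + 1) * (2 * k + 1 - 1) = 2 + 2 * (2 * (-1 - k) ^ 2 + 3 * (-1 - k)) by ring,
          zpow_add₀ hs0, zpow_mul]
        norm_cast
        field_simp) rfl)
  rw [← hT.unique (hasSum_altThetaProd hs0 hs hx)]
  field_simp
  ring

/-- Multiplying by qᵏx and by (qᵏx)³ raises the linear exponent 2k to 3k and 5k. Nothing is divided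
by 1 + (qᵏx)⁴, so the identity holds at the poles too, where the constant is computed. -/
theorem hasSum_quotSeries_combination (hq0 : q ≠ 0) (hq : ‖q‖ < 1) {x : ℂ} (hx : x ≠ 0) :
    HasSum (fun k : ℤ => q ^ (2 * k ^ 2 + 2 * k) * (x ^ 4) ^ k * quotSeries q (q ^ (4 * k) * x ^ 4) *
      ((q ^ k * x) * (1 - (q ^ k * x) ^ 2))) (quotConst q * (-altThetaProd q x / (q * x))) := by
  have hx4 : x ^ 4 ≠ 0 := pow_ne_zero _ hx
  refine hasSum_of_eq (((hasSum_quotSeries_shift hq0 hq (hasSum_quotCoeff_three hq0 hq) hx4).mul_left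
    x).sub ((hasSum_quotSeries_shift hq0 hq (hasSum_quotCoeff_five hq0 hq) hx4).mul_left (x ^ 3)))
    (fun k => ?_) ?_
  · rw [show 2 * k ^ 2 + 3 * k = (2 * k ^ 2 + 2 * k) + k by ring,
      show 2 * k ^ 2 + 5 * k = (2 * k ^ 2 + 2 * k) + k + k + k by ring]
    simp only [zpow_add₀ hq0 _ k]
    ring
  · rw [← thetaSum_sub_thetaSum hq0 hq hx]
    ring

theorem hasSum_chiSum (hq0 : q ≠ 0) (hq : ‖q‖ < 1) {x : ℂ} (hx : x ≠ 0)
    (hne : ∀ k : ℤ, 1 + (q ^ k * x) ^ 4 ≠ 0) :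
    HasSum (fun k : ℤ => thetaProd q (x ^ 4) * chiSum (q ^ k * x))
      (quotConst q * (-altThetaProd q x / (q * x))) := by
  have hx4 : x ^ 4 ≠ 0 := pow_ne_zero _ hx
  refine hasSum_of_eq (hasSum_quotSeries_combination hq0 hq hx) (fun k => ?_) rfl
  have e : (q ^ k * x) ^ 4 = q ^ (4 * k) * x ^ 4 := by
    rw [mul_pow, mul_comm 4 k, zpow_mul]; rfl
  rw [← thetaProd_shift hq0 hq hx4 k, ← quotSeries_mul hq0 hq (y := q ^ (4 * k) * x ^ 4)
    (mul_ne_zero (zpow_ne_zero _ hq0) hx4), chiSum, ← e]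
  have h := hne k
  generalize q ^ k * x = u at h ⊢
  field_simp

/-- The theta product vanishes at every -q^{4k}, but 1 + y vanishes only at the one with k = 0. -/
theorem quotSeries_eq_zero (hq0 : q ≠ 0) (hq : ‖q‖ < 1) {k : ℤ} (hk : k ≠ 0) :
    quotSeries q (q ^ (4 * k) * -1) = 0 := by
  have hq4 : ‖q ^ 4‖ < 1 := by rw [norm_pow]; exact pow_lt_one₀ (norm_nonneg _) hq four_ne_zero
  have h1 := quotSeries_mul hq0 hq (y := q ^ (4 * k) * -1)
    (mul_ne_zero (zpow_ne_zero _ hq0) (by simp))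
  have h2 := thetaProd_shift hq0 hq (y := -1) (by simp) k
  have h3 : thetaProd q (-1) = 0 := by
    rw [thetaProd, qPochInf_eq_mul hq4 (-(-1)⁻¹)]
    norm_num
  rw [h3] at h2
  have h4 : thetaProd q (q ^ (4 * k) * -1) = 0 :=
    (mul_eq_zero.mp h2).resolve_left (mul_ne_zero (zpow_ne_zero _ hq0) (zpow_ne_zero _ (by simp)))
  rw [h4] at h1
  refine (mul_eq_zero.mp h1).resolve_left fun h => ?_
  have h5 : ‖q‖ ^ (4 * k) = 1 := by
    rw [← norm_zpow, show q ^ (4 * k) = 1 by linear_combination -h, norm_one]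
  rw [zpow_eq_one_iff_right₀ (norm_nonneg _) hq.ne] at h5
  omega

theorem quotConst_mul (hq0 : q ≠ 0) (hq : ‖q‖ < 1) :
    quotConst q * qPochInf q q =
      q * qPochInf (q ^ 4) (q ^ 4) ^ 2 * qPochInf (q ^ 2) (q ^ 2) := by
  have hq2 : ‖q ^ 2‖ < 1 := by rw [norm_pow]; exact pow_lt_one₀ (norm_nonneg _) hq two_ne_zero
  have hq4 : ‖q ^ 4‖ < 1 := by rw [norm_pow]; exact pow_lt_one₀ (norm_nonneg _) hq four_ne_zero
  -- With x² = I one has x⁴ = -1, so all terms except k = 0 drop out.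
  obtain ⟨x, hx⟩ := IsAlgClosed.exists_pow_nat_eq I (n := 2) two_pos
  have hx0 : x ≠ 0 := fun h => I_ne_zero (by rw [← hx, h]; simp)
  have hx4 : x ^ 4 = -1 := by rw [show x ^ 4 = (x ^ 2) ^ 2 by ring, hx, I_sq]
  have h := hasSum_quotSeries_combination hq0 hq hx0
  rw [hx4] at h
  have h1 := h.unique (hasSum_single (0 : ℤ) fun k hk => by rw [quotSeries_eq_zero hq0 hq hk]; ring)
  have e1 : qPochInf (I⁻¹) q = (1 + I) * qPochInf (-(q * I)) q := by
    rw [qPochInf_eq_mul hq, inv_I]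
    congr 2 <;> ring
  have e2 : qPochInf (q * I) q * qPochInf (-(q * I)) q = qPochInf (-q ^ 2) (q ^ 2) := by
    rw [qPochInf_mul_neg hq, mul_pow, I_sq, mul_neg_one]
  have e3 : qPochInf (q ^ 2) (q ^ 2) * qPochInf (-q ^ 2) (q ^ 2) = qPochInf (q ^ 4) (q ^ 4) := by
    rw [qPochInf_mul_neg hq2, ← pow_mul]
  have hne4 := qPochInf_ne_zero_of_norm_lt hq4 hq4
  simp only [altThetaProd, hx, e1, zpow_zero, mul_zero, one_mul, quotSeries_neg_one hq0 hq] at h1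
  norm_num at h1
  have h2 : quotConst q * qPochInf q q * (1 + I) * qPochInf (-q ^ 2) (q ^ 2) =
      q * qPochInf (q ^ 4) (q ^ 4) ^ 3 * (I * (1 - I)) := by
    rw [← e2]
    field_simp at h1
    rw [hx, mul_comm I q] at h1
    linear_combination -h1
  have hI : 1 + I ≠ 0 := fun h => by simpa using congrArg re h
  refine mul_right_cancel₀ hne4 (mul_right_cancel₀ hI ?_)
  have : I * (1 - I) = 1 + I := by linear_combination -I_sq
  rw [this] at h2
  linear_combination qPochInf (q ^ 2) (q ^ 2) * h2 - quotConst q * qPochInf q q * (1 + I) * e3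

end

/-! ### The Kronecker symbol and the character χ₈ -/

theorem kronecker_eq_of_prime {a : ℤ} (χ : ℕ →* ℤ) (h2 : ZMod.χ₈ (a : ZMod 8) = χ 2)
    (hp : ∀ p : ℕ, p.Prime → p ≠ 2 → jacobiSym a p = χ p) {n : ℕ} (hn : n ≠ 0) :
    kronecker a n = χ n := by
  rw [kronecker, if_neg hn]
  conv_rhs => rw [← Nat.prod_primeFactorsList hn, map_list_prod]
  congr 1
  refine List.map_congr_left fun p hmem => ?_
  split_ifs with h
  · rw [h, h2]
  · exact hp p (Nat.prime_of_mem_primeFactorsList hmem) h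

/-- The character `χ₈` as a function on the natural numbers. -/
def chiEightHom : ℕ →* ℤ := (ZMod.χ₈ : ZMod 8 →* ℤ).comp (Nat.castRingHom (ZMod 8) : ℕ →* ZMod 8)

theorem chiEightHom_apply (n : ℕ) : chiEightHom n = ZMod.χ₈ (n : ZMod 8) := rfl

theorem chi8_eq (n : ℕ) : chi8 n = ZMod.χ₈ (n : ZMod 8) := by
  rcases eq_or_ne n 0 with rfl | hn
  · rw [chi8, kronecker, if_pos rfl]; decide
  · refine kronecker_eq_of_prime chiEightHom (by decide) (fun p hp h2 => ?_) hn
    have hodd := hp.odd_of_ne_two h2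
    rw [show (8 : ℤ) = 2 ^ 3 by norm_num, jacobiSym.pow_left, jacobiSym.at_two hodd,
      chiEightHom_apply, ← map_pow]
    have : ∀ a : ZMod 8, ZMod.χ₈ (a ^ 3) = ZMod.χ₈ a := by decide
    exact this _

theorem chi8_add_four (n : ℕ) : chi8 (n + 4) = -chi8 n := by
  rw [chi8_eq, chi8_eq]
  have : ∀ a : ZMod 8, ZMod.χ₈ (a + 4) = -ZMod.χ₈ a := by decide
  exact_mod_cast this n

theorem chi8_values : chi8 0 = 0 ∧ chi8 1 = 1 ∧ chi8 2 = 0 ∧ chi8 3 = -1 := by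
  simp only [chi8_eq]; decide

theorem norm_chi8_le (n : ℕ) : ‖(chi8 n : ℂ)‖ ≤ 1 := by
  rw [chi8_eq]
  have : ∀ a : ZMod 8, |ZMod.χ₈ a| ≤ 1 := by decide
  rw [Complex.norm_intCast]
  exact_mod_cast this n

theorem hasSum_chi8_pow {y : ℂ} (hy : ‖y‖ < 1) :
    HasSum (fun n : ℕ => (chi8 n : ℂ) * y ^ n) (chiSum y) := by
  have hs : Summable (fun n : ℕ => (chi8 n : ℂ) * y ^ n) := by
    refine .of_norm_bounded (summable_geometric_of_lt_one (norm_nonneg _) hy) fun n => ?_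
    rw [norm_mul, norm_pow]
    exact mul_le_of_le_one_left (by positivity) (norm_chi8_le n)
  -- Since χ₈(n + 4) = -χ₈(n), the sum F satisfies F = y - y³ - y⁴F.
  have h := hs.sum_add_tsum_nat_add 4
  have e : ∀ n : ℕ, (chi8 (n + 4) : ℂ) * y ^ (n + 4) = -y ^ 4 * ((chi8 n : ℂ) * y ^ n) := fun n => by
    rw [chi8_add_four]; push_cast; ring
  obtain ⟨c0, c1, c2, c3⟩ := chi8_values
  simp only [e, tsum_mul_left, Finset.sum_range_succ, Finset.sum_range_zero, c0, c1, c2, c3] at h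
  have hne : 1 + y ^ 4 ≠ 0 := fun h0 => by
    have h1 : ‖y ^ 4‖ < 1 := by rw [norm_pow]; exact pow_lt_one₀ (norm_nonneg _) hy four_ne_zero
    rw [eq_neg_of_add_eq_zero_right h0, norm_neg, norm_one] at h1
    exact lt_irrefl _ h1
  refine hasSum_of_eq hs.hasSum (fun n => rfl) ?_
  rw [chiSum, div_eq_iff hne]
  push_cast at h
  linear_combination h

theorem chiSum_inv {y : ℂ} (hy : y ≠ 0) (h : 1 + y ^ 4 ≠ 0) : chiSum y⁻¹ = -chiSum y := by
  have : y ^ 4 + 1 ≠ 0 := by rwa [add_comm]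
  rw [chiSum, chiSum]
  field_simp
  ring

/-! ### Lambert series as double series -/

theorem summable_prod_mul_of_nonneg {f g : ℕ → ℝ} (hf : Summable f) (hg : Summable g)
    (hf0 : ∀ n, 0 ≤ f n) (hg0 : ∀ n, 0 ≤ g n) : Summable fun p : ℕ × ℕ => f p.1 * g p.2 :=
  hf.mul_of_nonneg hg hf0 hg0

theorem norm_lambert_term_le {q v : ℂ} (hq : ‖q‖ < 1) (k n : ℕ) :
    ‖(chi8 n : ℂ) * (q ^ (k + 1) * v) ^ n‖ ≤ ‖q‖ ^ k * (‖q‖ * ‖v‖) ^ n := by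
  -- The bound |q|^{kn} ≤ |q|ᵏ fails at n = 0; there χ₈(0) = 0 removes the term.
  rcases Nat.eq_zero_or_pos n with h0 | hpos
  · rw [h0, chi8_values.1]
    simp only [Int.cast_zero, zero_mul, norm_zero]
    positivity
  · rw [norm_mul]
    refine (mul_le_of_le_one_left (norm_nonneg _) (norm_chi8_le _)).trans ?_
    rw [norm_pow, norm_mul, norm_pow, pow_succ, mul_assoc, mul_pow]
    refine mul_le_mul_of_nonneg_right ?_ (by positivity)
    exact pow_le_of_le_one (by positivity) (pow_le_one₀ (norm_nonneg _) hq.le) hpos.ne'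

theorem summable_lambert_double {q v : ℂ} (hq : ‖q‖ < 1) (hv : ‖q‖ * ‖v‖ < 1) :
    Summable (fun p : ℕ × ℕ => (chi8 p.2 : ℂ) * (q ^ (p.1 + 1) * v) ^ p.2) := by
  have hb : Summable (fun p : ℕ × ℕ => ‖q‖ ^ p.1 * (‖q‖ * ‖v‖) ^ p.2) :=
    summable_prod_mul_of_nonneg (summable_geometric_of_lt_one (norm_nonneg _) hq)
      (summable_geometric_of_lt_one (by positivity) hv) (fun _ => by positivity)
      (fun _ => by positivity)
  exact .of_norm_bounded hb fun p => norm_lambert_term_le hq p.1 p.2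

theorem hasSum_fiberwise_comm {f : ℕ × ℕ → ℂ} (hf : Summable f) {g h : ℕ → ℂ}
    (hg : ∀ k, HasSum (fun n => f (k, n)) (g k)) (hh : ∀ n, HasSum (fun k => f (k, n)) (h n)) :
    HasSum g (∑' p, f p) ∧ HasSum h (∑' p, f p) :=
  ⟨hf.hasSum.prod_fiberwise hg,
    ((Equiv.prodComm ℕ ℕ).hasSum_iff.mpr hf.hasSum).prod_fiberwise hh⟩

/-- The same double series summed in both orders: over n it gives `chiSum`, over k a geometric
series. -/
theorem exists_hasSum_lambert {q v : ℂ} (hq : ‖q‖ < 1) (hv : ‖q‖ * ‖v‖ < 1) :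
    ∃ S, HasSum (fun k : ℕ => chiSum (q ^ (k + 1) * v)) S ∧
      HasSum (fun n : ℕ => (chi8 n : ℂ) * (q ^ n / (1 - q ^ n)) * v ^ n) S := by
  have h1 : ∀ k : ℕ, HasSum (fun n : ℕ => (chi8 n : ℂ) * (q ^ (k + 1) * v) ^ n)
      (chiSum (q ^ (k + 1) * v)) := fun k => hasSum_chi8_pow (by
    rw [norm_mul, norm_pow, pow_succ, mul_assoc]
    exact (mul_le_of_le_one_left (by positivity) (pow_le_one₀ (norm_nonneg _) hq.le)).trans_lt hv)
  have h2 : ∀ n : ℕ, HasSum (fun k : ℕ => (chi8 n : ℂ) * (q ^ (k + 1) * v) ^ n)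
      ((chi8 n : ℂ) * (q ^ n / (1 - q ^ n)) * v ^ n) := fun n => by
    rcases Nat.eq_zero_or_pos n with h0 | hpos
    · rw [h0, chi8_values.1]
      simp
    · have hqn : ‖q ^ n‖ < 1 := by
        rw [norm_pow]; exact pow_lt_one₀ (norm_nonneg _) hq hpos.ne'
      refine hasSum_of_eq ((hasSum_geometric_of_norm_lt_one hqn).mul_left
        ((chi8 n : ℂ) * v ^ n * q ^ n)) (fun k => ?_) ?_
      · rw [mul_pow, ← pow_mul, ← pow_mul, show (k + 1) * n = n * k + n by ring, pow_add]; ring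
      · rw [div_eq_mul_inv]; ring
  exact ⟨_, hasSum_fiberwise_comm (f := fun p : ℕ × ℕ => (chi8 p.2 : ℂ) * (q ^ (p.1 + 1) * v) ^ p.2)
    (summable_lambert_double hq hv) h1 h2⟩

theorem exists_hasSum_bilateral {q x : ℂ} (hq0 : q ≠ 0) (hq : ‖q‖ < 1) (hx0 : x ≠ 0)
    (hx1 : ‖q‖ * ‖x‖ < 1) (hx2 : ‖q‖ * ‖x⁻¹‖ < 1) (hne : ∀ k : ℤ, 1 + (q ^ k * x) ^ 4 ≠ 0) :
    ∃ S, HasSum (fun n : ℕ => (chi8 n : ℂ) * (q ^ n / (1 - q ^ n)) * (x ^ n - x⁻¹ ^ n)) S ∧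
      HasSum (fun k : ℤ => chiSum (q ^ k * x)) (chiSum x + S) := by
  obtain ⟨S₁, h1, h1'⟩ := exists_hasSum_lambert hq hx1
  obtain ⟨S₂, h2, h2'⟩ := exists_hasSum_lambert hq hx2
  refine ⟨S₁ - S₂, hasSum_of_eq (h1'.sub h2') (fun n => by ring) rfl, ?_⟩
  rw [← add_sub_assoc, sub_eq_add_neg]
  refine HasSum.of_nat_of_neg_add_one ?_ ?_
  · refine hasSum_of_eq (HasSum.zero_add (f := fun n : ℕ => chiSum (q ^ n * x)) h1) (fun n => ?_) ?_
    · rw [zpow_natCast]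
    · rw [pow_zero, one_mul]
  · refine hasSum_of_eq h2.neg (fun n => ?_) rfl
    have h := hne (-(n + 1))
    rw [← chiSum_inv (mul_ne_zero (pow_ne_zero _ hq0) (inv_ne_zero hx0))]
    · rw [mul_inv, inv_inv, zpow_neg]
      norm_cast
    · intro h0
      apply h
      rw [zpow_neg, show q ^ ((n : ℤ) + 1) = q ^ (n + 1) by norm_cast]
      generalize q ^ (n + 1) = u at *
      have hu : u ≠ 0 := by rintro rfl; simp at h0
      field_simp at h0 ⊢
      linear_combination h0

/-! ### Theta functions as infinite products -/

section theta

theorem nome_ne_zero (τ : ℂ) : nome τ ≠ 0 := exp_ne_zero _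

theorem norm_nome (τ : ℂ) : ‖nome τ‖ = Real.exp (-(2 * Real.pi * τ.im)) := by
  rw [nome, norm_exp]
  congr 1
  simp

theorem norm_nome_lt_one {τ : ℂ} (hτ : 0 < τ.im) : ‖nome τ‖ < 1 := by
  rw [norm_nome, Real.exp_lt_one_iff]
  have := mul_pos Real.two_pi_pos hτ
  linarith

theorem nomePow_add (τ : ℂ) (r t : ℝ) : nomePow τ (r + t) = nomePow τ r * nomePow τ t := by
  rw [nomePow, nomePow, nomePow, ← exp_add]; congr 1; push_cast; ring

theorem nome_mul (τ : ℂ) (m : ℕ) : nome (m * τ) = nome τ ^ m := by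
  rw [nome, nome, ← exp_nat_mul]; congr 1; ring

theorem theta1_eq {τ : ℂ} (hτ : 0 < τ.im) (z : ℂ) :
    theta1 z τ = -I * nomePow τ (1 / 8) * (cexp (z * I) * altThetaProd (nome τ) (cexp (z * I))) := by
  set e := cexp (z * I) with he
  have he0 : e ≠ 0 := exp_ne_zero _
  set s := cexp (Real.pi * I * τ) with hs
  have hsq : s ^ 2 = nome τ := by rw [hs, nome, ← exp_nat_mul]; congr 1; push_cast; ring
  have hs1 : ‖s‖ < 1 := by
    have := norm_nome_lt_one hτ
    rw [← hsq, norm_pow] at this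
    exact (pow_lt_one_iff_of_nonneg (norm_nonneg _) two_ne_zero).mp this
  -- Pairing the indices -n and n + 1, which carry the same power of s, produces the sines.
  have h := ((Equiv.neg ℤ).hasSum_iff.mpr
    (hasSum_altThetaProd (exp_ne_zero _ : s ≠ 0) hs1 he0)).nat_add_neg_add_one
  have h2 := hasSum_of_eq (h.mul_left (e / (2 * I))) (g := fun n : ℕ => (-1 : ℂ) ^ n *
    nome τ ^ (n * (n + 1) / 2) * Complex.sin ((2 * (n : ℂ) + 1) * z)) (fun n => by
      simp only [Function.comp, Equiv.neg_apply, neg_neg]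
      have e1 : s ^ (-(n : ℤ) * (-n - 1)) = nome τ ^ (n * (n + 1) / 2) := by
        rw [← hsq, ← pow_mul, Nat.mul_div_cancel' (Nat.even_mul_succ_self n).two_dvd,
          show -(n : ℤ) * (-n - 1) = ((n * (n + 1) : ℕ) : ℤ) by push_cast; ring, zpow_natCast]
      have e2 : s ^ (((n : ℤ) + 1) * (n + 1 - 1)) = nome τ ^ (n * (n + 1) / 2) := by
        rw [← e1]; congr 1; ring
      have e3 : Complex.sin ((2 * (n : ℂ) + 1) * z) =
          (e ^ (2 * n + 1) - (e ^ (2 * n + 1))⁻¹) / (2 * I) := by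
        rw [he, ← exp_nat_mul, ← exp_neg, Complex.sin]
        push_cast
        field_simp
        rw [I_sq]
        ring_nf
      have e4 : (-(e ^ 2)⁻¹) ^ (-(n : ℤ)) = (-1) ^ n * e ^ (2 * n) := by
        rw [zpow_neg, zpow_natCast, ← inv_pow, inv_neg, inv_inv, neg_pow, pow_mul]
      have e5 : (-(e ^ 2)⁻¹) ^ ((n : ℤ) + 1) = (-1) ^ (n + 1) * (e ^ (2 * n + 2))⁻¹ := by
        rw [show (n : ℤ) + 1 = ((n + 1 : ℕ) : ℤ) by push_cast; ring, zpow_natCast, neg_pow, inv_pow,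
          ← pow_mul]
        ring_nf
      rw [e1, e2, e3, e4, e5]
      field_simp
      ring) rfl
  rw [theta1, h2.tsum_eq, hsq]
  field_simp
  rw [I_sq]
  ring

theorem theta2_eq_theta1 (z τ : ℂ) : theta2 z τ = theta1 (z + Real.pi / 2) τ := by
  rw [theta1, theta2]
  congr 1
  refine tsum_congr fun n => ?_
  have : Complex.sin ((2 * (n : ℂ) + 1) * (z + Real.pi / 2)) =
      (-1) ^ n * Complex.cos ((2 * (n : ℂ) + 1) * z) := by
    rw [show (2 * (n : ℂ) + 1) * (z + Real.pi / 2) =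
      ((2 * (n : ℂ) + 1) * z + Real.pi / 2) + n * Real.pi by ring, Complex.sin_antiperiodic.add_nat_mul_eq,
      Complex.sin_add_pi_div_two]
  rw [this]
  linear_combination (norm := ring_nf) -(nome τ ^ (n * (n + 1) / 2) *
    Complex.cos ((2 * (n : ℂ) + 1) * z)) * Even.neg_one_pow (α := ℂ) (Even.add_self n)

theorem theta2_four_eq {τ : ℂ} (hτ : 0 < τ.im) (z : ℂ) :
    theta2 (4 * z) (4 * τ) = nomePow τ (1 / 2) * (cexp (2 * z * I) ^ 2 *
      thetaProd (nome τ) (cexp (2 * z * I) ^ 4)) := by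
  have h4 : nome (4 * τ) = nome τ ^ 4 := nome_mul τ 4
  have hp : nomePow (4 * τ) (1 / 8) = nomePow τ (1 / 2) := by
    rw [nomePow, nomePow]; congr 1; push_cast; ring
  have he : cexp ((4 * z + Real.pi / 2) * I) = I * cexp (2 * z * I) ^ 2 := by
    rw [add_mul, exp_add, exp_pi_div_two_mul_I, mul_comm, ← exp_nat_mul]
    congr 2
    push_cast; ring
  rw [theta2_eq_theta1, theta1_eq (by simpa using hτ), h4, hp, he, altThetaProd, thetaProd]
  rw [mul_pow, I_sq, ← pow_mul, neg_one_mul, inv_neg, mul_neg]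
  linear_combination (-(nomePow τ (1 / 2) * (cexp (2 * z * I) ^ 2 * (qPochInf (nome τ ^ 4) (nome τ ^ 4) *
    (qPochInf (-(cexp (2 * z * I) ^ 4)⁻¹) (nome τ ^ 4) * qPochInf (-(nome τ ^ 4 * cexp (2 * z * I) ^ 4))
      (nome τ ^ 4)))))) * I_sq

end theta

/-! ### The identity on the strip -/

theorem norm_exp_two_mul_I (z : ℂ) : ‖cexp (2 * z * I)‖ = Real.exp (-(2 * z.im)) := by
  rw [norm_exp]; congr 1; simp

theorem one_add_exp_pow_four (z : ℂ) :
    1 + cexp (2 * z * I) ^ 4 = 2 * cexp (2 * z * I) ^ 2 * Complex.cos (4 * z) := by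
  rw [Complex.cos, ← exp_nat_mul, ← exp_nat_mul, mul_div_assoc', eq_div_iff two_ne_zero,
    show (2 : ℂ) * cexp ((2 : ℕ) * (2 * z * I)) * (cexp (4 * z * I) + cexp (-(4 * z) * I)) =
      2 * (cexp ((2 : ℕ) * (2 * z * I)) * cexp (4 * z * I)
        + cexp ((2 : ℕ) * (2 * z * I)) * cexp (-(4 * z) * I)) by ring, ← exp_add, ← exp_add,
    show ((2 : ℕ) : ℂ) * (2 * z * I) + -(4 * z) * I = 0 by push_cast; ring, exp_zero,
    show ((2 : ℕ) : ℂ) * (2 * z * I) + 4 * z * I = (4 : ℕ) * (2 * z * I) by push_cast; ring]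
  ring

theorem sin_div_cos_eq (z : ℂ) :
    Complex.sin (2 * z) / Complex.cos (4 * z) = I * chiSum (cexp (2 * z * I)) := by
  have hx : cexp (2 * z * I) ≠ 0 := exp_ne_zero _
  rw [chiSum, one_add_exp_pow_four, Complex.sin, neg_mul, exp_neg]
  field_simp

theorem sin_two_mul_nat (n : ℕ) (z : ℂ) : Complex.sin (2 * (n : ℂ) * z) =
    (2 * I)⁻¹ * (cexp (2 * z * I) ^ n - (cexp (2 * z * I))⁻¹ ^ n) := by
  have hx : cexp (2 * z * I) ≠ 0 := exp_ne_zero _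
  rw [inv_pow, ← exp_nat_mul, ← exp_neg, Complex.sin]
  field_simp
  rw [I_sq]
  ring_nf

theorem hasSum_pnat_of_chi8 {q : ℂ} {w : ℕ → ℂ} {S : ℂ}
    (h : HasSum (fun n : ℕ => (chi8 n : ℂ) * (q ^ n / (1 - q ^ n)) * w n) S) :
    HasSum (fun n : ℕ+ => (chi8 n : ℂ) * (q ^ (n : ℕ) / (1 - q ^ (n : ℕ))) * w n) S := by
  refine (hasSum_pnat_iff (f := fun n : ℕ => (chi8 n : ℂ) * (q ^ n / (1 - q ^ n)) * w n)).mpr ?_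
  rw [chi8_values.1]
  simpa using h

/-- A zero forces |qᵏx| = 1, that is Im z = -kπ Im τ; the strip leaves only k = 0, which is excluded
by cos 4z ≠ 0. -/
theorem one_add_zpow_mul_ne_zero {τ z : ℂ} (hz : |z.im| < Real.pi * τ.im)
    (hc : Complex.cos (4 * z) ≠ 0) (k : ℤ) : 1 + (nome τ ^ k * cexp (2 * z * I)) ^ 4 ≠ 0 := by
  intro h
  have hn : ‖nome τ ^ k * cexp (2 * z * I)‖ = 1 := by
    have h1 : ‖(nome τ ^ k * cexp (2 * z * I)) ^ 4‖ = 1 := by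
      rw [eq_neg_of_add_eq_zero_right h, norm_neg, norm_one]
    rw [norm_pow] at h1
    exact (pow_eq_one_iff_of_nonneg (norm_nonneg _) four_ne_zero).mp h1
  have he : (k * (2 * Real.pi * I * τ) + 2 * z * I).re = -(2 * Real.pi * τ.im * k) - 2 * z.im := by
    simp
    ring
  rw [nome, ← exp_int_mul, ← exp_add, norm_exp, Real.exp_eq_one_iff, he] at hn
  have hpos : 0 < Real.pi * τ.im := (abs_nonneg _).trans_lt hz
  obtain ⟨hz1, hz2⟩ := abs_lt.mp hz
  have hk : k = 0 := by
    rcases lt_trichotomy k 0 with hk | hk | hk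
    · have : (k : ℝ) ≤ -1 := by exact_mod_cast Int.le_sub_one_of_lt hk
      nlinarith
    · exact hk
    · have : (1 : ℝ) ≤ k := by exact_mod_cast hk
      nlinarith
  rw [hk, zpow_zero, one_mul, one_add_exp_pow_four] at h
  exact mul_ne_zero (mul_ne_zero two_ne_zero (pow_ne_zero _ (exp_ne_zero _))) hc h

theorem thetaProd_ne_zero {q x : ℂ} (hq0 : q ≠ 0) (hq : ‖q‖ < 1) (hx : x ≠ 0)
    (hne : ∀ k : ℤ, 1 + (q ^ k * x) ^ 4 ≠ 0) : thetaProd q (x ^ 4) ≠ 0 := by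
  have hq4 : ‖q ^ 4‖ < 1 := by rw [norm_pow]; exact pow_lt_one₀ (norm_nonneg _) hq four_ne_zero
  refine mul_ne_zero (qPochInf_ne_zero_of_norm_lt hq4 hq4) (mul_ne_zero
    (qPochInf_ne_zero hq4 fun k h => hne (-k) ?_) (qPochInf_ne_zero hq4 fun k h => hne (k + 1) ?_))
  · rw [zpow_neg, zpow_natCast, mul_pow, inv_pow, ← pow_mul, mul_comm k 4, pow_mul]
    have : (q ^ 4) ^ k ≠ 0 := pow_ne_zero _ (pow_ne_zero _ hq0)
    field_simp at h ⊢
    linear_combination -h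
  · rw [show (k : ℤ) + 1 = ((k + 1 : ℕ) : ℤ) by push_cast; ring, zpow_natCast]
    linear_combination -h

theorem eulerProd_ne_zero {τ : ℂ} (hτ : 0 < τ.im) {m : ℕ} (hm : m ≠ 0) : eulerProd m τ ≠ 0 := by
  have h : ‖nome τ ^ m‖ < 1 := by
    rw [norm_pow]; exact pow_lt_one₀ (norm_nonneg _) (norm_nome_lt_one hτ) hm
  exact qPochInf_ne_zero_of_norm_lt h h

theorem nomePow_ne_zero (τ : ℂ) (r : ℝ) : nomePow τ r ≠ 0 := exp_ne_zero _

theorem nomePow_half (τ : ℂ) : nomePow τ (1 / 2) = nomePow τ (3 / 8) * nomePow τ (1 / 8) := by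
  rw [← nomePow_add]; norm_num

/-- The Lambert series identity on the strip. -/
theorem lambert_identity {τ : ℂ} (hτ : 0 < τ.im) {z : ℂ} (hz : |z.im| < Real.pi * τ.im)
    (hc : Complex.cos (4 * z) ≠ 0) :
    theta2 (4 * z) (4 * τ) ≠ 0 ∧
      Summable (fun n : ℕ+ =>
        (chi8 n : ℂ) * (nome τ ^ (n : ℕ) / (1 - nome τ ^ (n : ℕ))) *
          Complex.sin (2 * ((n : ℕ) : ℂ) * z)) ∧
      Complex.sin (2 * z) / Complex.cos (4 * z)
          - 2 * ∑' n : ℕ+, (chi8 n : ℂ) * (nome τ ^ (n : ℕ) / (1 - nome τ ^ (n : ℕ)))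
              * Complex.sin (2 * ((n : ℕ) : ℂ) * z)
        = nomePow τ (3 / 8) * (eulerProd 4 τ ^ 2 * eulerProd 2 τ / eulerProd 1 τ)
            * (theta1 (2 * z) τ / theta2 (4 * z) (4 * τ)) := by
  have hq0 := nome_ne_zero τ
  have hq := norm_nome_lt_one hτ
  have hx0 : cexp (2 * z * I) ≠ 0 := exp_ne_zero _
  have hne := one_add_zpow_mul_ne_zero hz hc
  obtain ⟨hz1, hz2⟩ := abs_lt.mp hz
  have hP := thetaProd_ne_zero hq0 hq hx0 hne
  have ht2 := theta2_four_eq hτ z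
  have hp8 := nomePow_ne_zero τ (1 / 8)
  have hp38 := nomePow_ne_zero τ (3 / 8)
  obtain ⟨S, hS, hS'⟩ := exists_hasSum_bilateral hq0 hq hx0
    (by rw [norm_nome, norm_exp_two_mul_I, ← Real.exp_add, Real.exp_lt_one_iff]; linarith)
    (by rw [norm_inv, norm_nome, norm_exp_two_mul_I, ← Real.exp_neg, ← Real.exp_add,
      Real.exp_lt_one_iff]; linarith) hne
  have hsum := hasSum_pnat_of_chi8 (q := nome τ) (w := fun n => Complex.sin (2 * (n : ℂ) * z))
    (hasSum_of_eq (hS.mul_left (2 * I)⁻¹) (fun n => by rw [sin_two_mul_nat]; ring) rfl)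
  have hV := (hS'.mul_left (thetaProd (nome τ) (cexp (2 * z * I) ^ 4))).unique
    (hasSum_chiSum hq0 hq hx0 hne)
  have hK := quotConst_mul hq0 hq
  have he1 : eulerProd 1 τ = qPochInf (nome τ) (nome τ) := by rw [eulerProd, pow_one]
  have hE1 := eulerProd_ne_zero hτ one_ne_zero
  rw [he1] at hE1
  refine ⟨?_, hsum.summable, ?_⟩
  · rw [ht2]
    exact mul_ne_zero (nomePow_ne_zero _ _) (mul_ne_zero (pow_ne_zero _ hx0) hP)
  · rw [hsum.tsum_eq, sin_div_cos_eq z, theta1_eq hτ, ht2, nomePow_half, he1, eulerProd, eulerProd]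
    have hK' : quotConst (nome τ) = nome τ * (qPochInf (nome τ ^ 4) (nome τ ^ 4) ^ 2 *
        qPochInf (nome τ ^ 2) (nome τ ^ 2) / qPochInf (nome τ) (nome τ)) := by
      field_simp
      linear_combination hK
    rw [hK'] at hV
    have hV' : chiSum (cexp (2 * z * I)) + S = (nome τ * (qPochInf (nome τ ^ 4) (nome τ ^ 4) ^ 2 *
        qPochInf (nome τ ^ 2) (nome τ ^ 2) / qPochInf (nome τ) (nome τ))) *
        (-altThetaProd (nome τ) (cexp (2 * z * I)) / (nome τ * cexp (2 * z * I))) /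
          thetaProd (nome τ) (cexp (2 * z * I) ^ 4) := by
      rw [eq_div_iff hP, mul_comm, hV]
    -- Here -2/(2I) = I, so both parts of the left side carry the same factor I.
    have : I * chiSum (cexp (2 * z * I)) - 2 * ((2 * I)⁻¹ * S) =
        I * (chiSum (cexp (2 * z * I)) + S) := by
      field_simp
      rw [I_sq]
      ring
    rw [this, hV']
    field_simp

/-! ### Product forms and characters for the special values -/

theorem theta1_eq_prod {τ : ℂ} (hτ : 0 < τ.im) (z : ℂ) :
    theta1 z τ = 2 * nomePow τ (1 / 8) * Complex.sin z * (eulerProd 1 τ *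
      (qPochInf (nome τ * cexp (z * I) ^ 2) (nome τ) *
        qPochInf (nome τ * (cexp (z * I) ^ 2)⁻¹) (nome τ))) := by
  have he0 : cexp (z * I) ≠ 0 := exp_ne_zero _
  have hs : Complex.sin z = ((cexp (z * I))⁻¹ - cexp (z * I)) * I / 2 := by
    rw [Complex.sin, neg_mul, exp_neg]
  rw [theta1_eq hτ, altThetaProd, qPochInf_eq_mul (norm_nome_lt_one hτ) (cexp (z * I) ^ 2)⁻¹,
    mul_comm (cexp (z * I) ^ 2)⁻¹ (nome τ), eulerProd, pow_one, hs]
  field_simp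
  ring

theorem theta2_eq_prod {τ : ℂ} (hτ : 0 < τ.im) (z : ℂ) :
    theta2 z τ = 2 * nomePow τ (1 / 8) * Complex.cos z * (eulerProd 1 τ *
      (qPochInf (-nome τ * cexp (z * I) ^ 2) (nome τ) *
        qPochInf (-nome τ * (cexp (z * I) ^ 2)⁻¹) (nome τ))) := by
  have he : cexp ((z + Real.pi / 2) * I) = I * cexp (z * I) := by
    rw [add_mul, exp_add, exp_pi_div_two_mul_I, mul_comm]
  rw [theta2_eq_theta1, theta1_eq_prod hτ, he, Complex.sin_add_pi_div_two, mul_pow, I_sq,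
    neg_one_mul, inv_neg]
  simp only [mul_neg, neg_mul]

theorem theta2_four_mul_eq_prod {τ : ℂ} (hτ : 0 < τ.im) (z : ℂ) :
    theta2 z (4 * τ) = 2 * nomePow τ (1 / 2) * Complex.cos z * (eulerProd 4 τ *
      (qPochInf (-nome τ ^ 4 * cexp (z * I) ^ 2) (nome τ ^ 4) *
        qPochInf (-nome τ ^ 4 * (cexp (z * I) ^ 2)⁻¹) (nome τ ^ 4))) := by
  have h4 : nome (4 * τ) = nome τ ^ 4 := nome_mul τ 4
  have hp : nomePow (4 * τ) (1 / 8) = nomePow τ (1 / 2) := by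
    rw [nomePow, nomePow]; congr 1; push_cast; ring
  rw [theta2_eq_prod (by simpa using hτ), hp, eulerProd, pow_one, h4, eulerProd]

theorem qPochInf_neg_nome {τ : ℂ} (hτ : 0 < τ.im) {m : ℕ} (hm : m ≠ 0) :
    qPochInf (-nome τ ^ m) (nome τ ^ m) = eulerProd (2 * m) τ / eulerProd m τ := by
  have h : ‖nome τ ^ m‖ < 1 := by
    rw [norm_pow]; exact pow_lt_one₀ (norm_nonneg _) (norm_nome_lt_one hτ) hm
  rw [eq_div_iff (eulerProd_ne_zero hτ hm), eulerProd, mul_comm, qPochInf_mul_neg h, eulerProd,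
    ← pow_mul, mul_comm m 2]

/-- Factor by factor, (1 - t)(1 - tw)(1 - tw²) = 1 - t³ for a primitive cube root of unity w. -/
theorem qPochInf_cube {q w : ℂ} (hq : ‖q‖ < 1) (hw : 1 + w + w ^ 2 = 0) (a : ℂ) :
    qPochInf a q * (qPochInf (a * w) q * qPochInf (a * w ^ 2) q) = qPochInf (a ^ 3) (q ^ 3) := by
  have hq3 : ‖q ^ 3‖ < 1 := by rw [norm_pow]; exact pow_lt_one₀ (norm_nonneg _) hq three_ne_zero
  refine tendsto_nhds_unique ((tendsto_qPoch hq a).mul ((tendsto_qPoch hq (a * w)).mul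
    (tendsto_qPoch hq (a * w ^ 2)))) ?_
  refine (tendsto_qPoch hq3 (a ^ 3)).congr fun n => ?_
  rw [← Finset.prod_mul_distrib, ← Finset.prod_mul_distrib]
  refine Finset.prod_congr rfl fun k _ => ?_
  rw [← pow_mul, mul_comm 3 k, pow_mul]
  generalize q ^ k = u
  linear_combination (a * u - a ^ 2 * u ^ 2 * w + a ^ 3 * u ^ 3 * (w - 1)) * hw

/-- The Jacobi symbol `(n / 3)` as a function on the natural numbers. -/
def jacobiThreeHom : ℕ →* ℤ where
  toFun n := jacobiSym n 3
  map_one' := by simp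
  map_mul' m n := by rw [Nat.cast_mul, jacobiSym.mul_left]

theorem jacobiSym_neg_three {p : ℕ} (hp : Odd p) : jacobiSym (-3) p = jacobiSym p 3 := by
  rw [show (-3 : ℤ) = -1 * (3 : ℕ) by norm_num, jacobiSym.mul_left, jacobiSym.at_neg_one hp,
    jacobiSym.quadratic_reciprocity (by decide) hp, ZMod.χ₄_eq_neg_one_pow (Nat.odd_iff.mp hp),
    ← mul_assoc, ← pow_add, Even.neg_one_pow ⟨p / 2, by omega⟩, one_mul]

theorem chiEight_pow_three (a : ZMod 8) : ZMod.χ₈ a ^ 3 = ZMod.χ₈ a := by revert a; decide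

/-- Write -24 = 2³ · (-3): reciprocity turns (-3/p) into (p/3), and at the prime 2 both sides
vanish. -/
theorem kronecker_neg_twentyfour {n : ℕ} (hn : n ≠ 0) :
    kronecker (-24) n = chi8 n * jacobiSym n 3 := by
  rw [chi8_eq]
  refine kronecker_eq_of_prime (chiEightHom * jacobiThreeHom) ?_ (fun p hp h2 => ?_) hn
  · rw [MonoidHom.mul_apply, chiEightHom_apply, show ZMod.χ₈ ((2 : ℕ) : ZMod 8) = 0 by decide,
      zero_mul]
    decide
  · have hodd := hp.odd_of_ne_two h2
    rw [show (-24 : ℤ) = 2 ^ 3 * -3 by norm_num, jacobiSym.mul_left, jacobiSym.pow_left,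
      jacobiSym.at_two hodd, jacobiSym_neg_three hodd, chiEight_pow_three]
    rfl

/-- The character `χ₄` as a function on the natural numbers. -/
def chiFourHom : ℕ →* ℤ := (ZMod.χ₄ : ZMod 4 →* ℤ).comp (Nat.castRingHom (ZMod 4) : ℕ →* ZMod 4)

theorem kronecker_neg_thirtytwo {n : ℕ} (hn : n ≠ 0) :
    kronecker (-32) n = chi8 n * ZMod.χ₄ n := by
  rw [chi8_eq]
  refine kronecker_eq_of_prime (chiEightHom * chiFourHom) ?_ (fun p hp h2 => ?_) hn
  · rw [MonoidHom.mul_apply, chiEightHom_apply, show ZMod.χ₈ ((2 : ℕ) : ZMod 8) = 0 by decide,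
      zero_mul]
    decide
  · have hodd := hp.odd_of_ne_two h2
    rw [show (-32 : ℤ) = 2 ^ 5 * -1 by norm_num, jacobiSym.mul_left, jacobiSym.pow_left,
      jacobiSym.at_two hodd, jacobiSym.at_neg_one hodd, pow_add (ZMod.χ₈ _) 2 3,
      chiEight_pow_three, ← pow_succ, chiEight_pow_three]
    rfl

theorem sin_two_mul_nat_pi_div_three (n : ℕ) :
    Complex.sin (2 * (n : ℂ) * ((Real.pi / 3 : ℝ) : ℂ)) = ((√3 / 2 : ℝ) : ℂ) * jacobiSym n 3 := by
  have hper : ∀ x : ℝ, Real.sin (x + ((n / 3 : ℕ) : ℝ) * (2 * Real.pi)) = Real.sin x :=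
    fun x => Real.sin_periodic.nat_mul (n / 3) x
  have hn : (n : ℝ) = (n % 3 : ℕ) + 3 * (n / 3 : ℕ) := by exact_mod_cast (Nat.mod_add_div n 3).symm
  have hr : Real.sin (2 * n * (Real.pi / 3)) = √3 / 2 * jacobiSym n 3 := by
    rw [show 2 * (n : ℝ) * (Real.pi / 3) = 2 * (n % 3 : ℕ) * (Real.pi / 3) +
      ((n / 3 : ℕ) : ℝ) * (2 * Real.pi) by rw [hn]; ring, hper,
      jacobiSym.mod_left, show ((n : ℤ) % (3 : ℕ)) = ((n % 3 : ℕ) : ℤ) by norm_cast]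
    have hlt := Nat.mod_lt n (show 3 > 0 by norm_num)
    generalize n % 3 = r at hlt
    interval_cases r
    · simp [show jacobiSym 0 3 = 0 by norm_num]
    · rw [show 2 * ((1 : ℕ) : ℝ) * (Real.pi / 3) = Real.pi - Real.pi / 3 by push_cast; ring,
        Real.sin_pi_sub, Real.sin_pi_div_three, show jacobiSym ((1 : ℕ) : ℤ) 3 = 1 by norm_num]
      simp
    · rw [show 2 * ((2 : ℕ) : ℝ) * (Real.pi / 3) = Real.pi / 3 + Real.pi by push_cast; ring,
        Real.sin_add_pi, Real.sin_pi_div_three, show jacobiSym ((2 : ℕ) : ℤ) 3 = -1 by norm_num]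
      simp
  have h := congrArg (fun t : ℝ => (t : ℂ)) hr
  push_cast at h ⊢
  exact h

theorem sin_two_mul_nat_pi_div_four (n : ℕ) :
    Complex.sin (2 * (n : ℂ) * ((Real.pi / 4 : ℝ) : ℂ)) = ((ZMod.χ₄ n : ℤ) : ℂ) := by
  have hper : ∀ x : ℝ, Real.sin (x + ((n / 4 : ℕ) : ℝ) * (2 * Real.pi)) = Real.sin x :=
    fun x => Real.sin_periodic.nat_mul (n / 4) x
  have hn : (n : ℝ) = (n % 4 : ℕ) + 4 * (n / 4 : ℕ) := by exact_mod_cast (Nat.mod_add_div n 4).symm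
  have hr : Real.sin (2 * n * (Real.pi / 4)) = (ZMod.χ₄ n : ℤ) := by
    rw [show 2 * (n : ℝ) * (Real.pi / 4) = 2 * (n % 4 : ℕ) * (Real.pi / 4) +
      ((n / 4 : ℕ) : ℝ) * (2 * Real.pi) by rw [hn]; ring, hper,
      ZMod.χ₄_nat_mod_four]
    have hlt := Nat.mod_lt n (show 4 > 0 by norm_num)
    generalize n % 4 = r at hlt
    interval_cases r
    · simp
    · rw [show 2 * ((1 : ℕ) : ℝ) * (Real.pi / 4) = Real.pi / 2 by push_cast; ring,
        Real.sin_pi_div_two, show ZMod.χ₄ ((1 : ℕ) : ZMod 4) = 1 by decide]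
      simp
    · rw [show 2 * ((2 : ℕ) : ℝ) * (Real.pi / 4) = Real.pi by push_cast; ring,
        Real.sin_pi, show ZMod.χ₄ ((2 : ℕ) : ZMod 4) = 0 by decide]
      simp
    · rw [show 2 * ((3 : ℕ) : ℝ) * (Real.pi / 4) = Real.pi / 2 + Real.pi by push_cast; ring,
        Real.sin_add_pi, Real.sin_pi_div_two, show ZMod.χ₄ ((3 : ℕ) : ZMod 4) = -1 by decide]
      simp
  have h := congrArg (fun t : ℝ => (t : ℂ)) hr
  push_cast at h ⊢
  exact h

theorem lambert_pi_div_four {τ : ℂ} (hτ : 0 < τ.im) :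
    Summable (fun n : ℕ+ => (kronecker (-32) n : ℂ) *
        (nome τ ^ (n : ℕ) / (1 - nome τ ^ (n : ℕ)))) ∧
      1 + 2 * ∑' n : ℕ+, (kronecker (-32) n : ℂ) * (nome τ ^ (n : ℕ) / (1 - nome τ ^ (n : ℕ)))
        = eulerProd 2 τ ^ 3 * eulerProd 4 τ ^ 3 / (eulerProd 1 τ ^ 2 * eulerProd 8 τ ^ 2) := by
  have hc4 : Complex.cos (4 * ((Real.pi / 4 : ℝ) : ℂ)) = -1 := by
    rw [show 4 * ((Real.pi / 4 : ℝ) : ℂ) = Real.pi by push_cast; ring, Complex.cos_pi]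
  have hs2 : Complex.sin (2 * ((Real.pi / 4 : ℝ) : ℂ)) = 1 := by
    rw [show 2 * ((Real.pi / 4 : ℝ) : ℂ) = Real.pi / 2 by push_cast; ring, Complex.sin_pi_div_two]
  have hterm : ∀ n : ℕ+, (chi8 n : ℂ) * (nome τ ^ (n : ℕ) / (1 - nome τ ^ (n : ℕ))) *
      Complex.sin (2 * ((n : ℕ) : ℂ) * ((Real.pi / 4 : ℝ) : ℂ)) =
      (kronecker (-32) n : ℂ) * (nome τ ^ (n : ℕ) / (1 - nome τ ^ (n : ℕ))) := fun n => by
    rw [sin_two_mul_nat_pi_div_four, kronecker_neg_thirtytwo n.ne_zero]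
    push_cast
    ring
  obtain ⟨-, h1, h2⟩ := lambert_identity hτ (z := ((Real.pi / 4 : ℝ) : ℂ))
    (by rw [ofReal_im, abs_zero]; exact mul_pos Real.pi_pos hτ) (by rw [hc4]; simp)
  simp only [hterm] at h1 h2
  refine ⟨h1, ?_⟩
  have e1 : cexp (2 * ((Real.pi / 4 : ℝ) : ℂ) * I) ^ 2 = -1 := by
    rw [← exp_nat_mul, ← exp_pi_mul_I]; congr 1; push_cast; ring
  have e2 : cexp (4 * ((Real.pi / 4 : ℝ) : ℂ) * I) ^ 2 = 1 := by
    rw [← exp_nat_mul, ← exp_two_pi_mul_I]; congr 1; push_cast; ring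
  have p1 := qPochInf_neg_nome hτ one_ne_zero
  rw [pow_one, mul_one] at p1
  have p4 := qPochInf_neg_nome hτ four_ne_zero
  rw [show 2 * 4 = 8 by norm_num] at p4
  rw [theta1_eq_prod hτ, theta2_four_mul_eq_prod hτ, e1, e2, nomePow_half] at h2
  simp only [hs2, hc4, inv_neg, inv_one, mul_neg_one, mul_one, p1, p4] at h2
  have := nomePow_ne_zero τ (1 / 8)
  have := nomePow_ne_zero τ (3 / 8)
  have := eulerProd_ne_zero hτ one_ne_zero
  have := eulerProd_ne_zero hτ four_ne_zero
  have := eulerProd_ne_zero hτ (m := 8) (by norm_num)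
  have := eulerProd_ne_zero hτ two_ne_zero
  -- Since cos 4z = -1, the specialised identity is the negative of the desired one.
  refine neg_injective (Eq.trans ?_ (h2.trans ?_))
  · ring
  · field_simp

theorem lambert_pi_div_three {τ : ℂ} (hτ : 0 < τ.im) :
    Summable (fun n : ℕ+ => (kronecker (-24) n : ℂ) *
        (nome τ ^ (n : ℕ) / (1 - nome τ ^ (n : ℕ)))) ∧
      1 + ∑' n : ℕ+, (kronecker (-24) n : ℂ) * (nome τ ^ (n : ℕ) / (1 - nome τ ^ (n : ℕ)))
        = eulerProd 2 τ * eulerProd 3 τ * eulerProd 8 τ * eulerProd 12 τ /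
          (eulerProd 1 τ * eulerProd 24 τ) := by
  have hq := norm_nome_lt_one hτ
  have hq4 : ‖nome τ ^ 4‖ < 1 := by rw [norm_pow]; exact pow_lt_one₀ (norm_nonneg _) hq four_ne_zero
  have hr3 : ((√3 / 2 : ℝ) : ℂ) ≠ 0 := by
    rw [ofReal_ne_zero]; positivity
  have hc4 : Complex.cos (4 * ((Real.pi / 3 : ℝ) : ℂ)) = -1 / 2 := by
    rw [show 4 * ((Real.pi / 3 : ℝ) : ℂ) = ((Real.pi / 3 + Real.pi : ℝ) : ℂ) by push_cast; ring,
      ← ofReal_cos, Real.cos_add_pi, Real.cos_pi_div_three]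
    push_cast; ring
  have hs2 : Complex.sin (2 * ((Real.pi / 3 : ℝ) : ℂ)) = ((√3 / 2 : ℝ) : ℂ) := by
    rw [show 2 * ((Real.pi / 3 : ℝ) : ℂ) = ((Real.pi - Real.pi / 3 : ℝ) : ℂ) by push_cast; ring,
      ← ofReal_sin, Real.sin_pi_sub, Real.sin_pi_div_three]
  have hterm : ∀ n : ℕ+, (chi8 n : ℂ) * (nome τ ^ (n : ℕ) / (1 - nome τ ^ (n : ℕ))) *
      Complex.sin (2 * ((n : ℕ) : ℂ) * ((Real.pi / 3 : ℝ) : ℂ)) = ((√3 / 2 : ℝ) : ℂ) *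
      ((kronecker (-24) n : ℂ) * (nome τ ^ (n : ℕ) / (1 - nome τ ^ (n : ℕ)))) := fun n => by
    rw [sin_two_mul_nat_pi_div_three, kronecker_neg_twentyfour n.ne_zero]
    push_cast
    ring
  obtain ⟨-, h1, h2⟩ := lambert_identity hτ (z := ((Real.pi / 3 : ℝ) : ℂ))
    (by rw [ofReal_im, abs_zero]; exact mul_pos Real.pi_pos hτ) (by rw [hc4]; norm_num)
  simp only [hterm, tsum_mul_left] at h1 h2
  refine ⟨(summable_mul_left_iff hr3).mp h1, ?_⟩
  obtain ⟨w, hw⟩ : ∃ w, w = cexp (2 * ((Real.pi / 3 : ℝ) : ℂ) * I) := ⟨_, rfl⟩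
  have hw3 : w ^ 3 = 1 := by
    rw [hw, ← exp_nat_mul, ← exp_two_pi_mul_I]; congr 1; push_cast; ring
  have hw1 : w ≠ 1 := by
    intro h
    have h' := congrArg im (hw.symm.trans h)
    rw [show 2 * ((Real.pi / 3 : ℝ) : ℂ) = ((Real.pi - Real.pi / 3 : ℝ) : ℂ) by push_cast; ring,
      exp_ofReal_mul_I_im, Real.sin_pi_sub, Real.sin_pi_div_three, one_im] at h'
    have : (0 : ℝ) < √3 / 2 := by positivity
    exact this.ne' h'
  have hw2 : 1 + w + w ^ 2 = 0 := by
    refine (mul_eq_zero.mp (?_ : (w - 1) * (1 + w + w ^ 2) = 0)).resolve_left (sub_ne_zero.mpr hw1)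
    linear_combination hw3
  have hw0 : w ≠ 0 := fun h => by simp [h] at hw3
  have i1 : (w ^ 2)⁻¹ = w := by
    field_simp; exact hw3.symm
  have e2 : cexp (4 * ((Real.pi / 3 : ℝ) : ℂ) * I) = w ^ 2 := by
    rw [hw, ← exp_nat_mul]; congr 1; push_cast; ring
  have i2 : (w ^ 2) ^ 2 = w := by linear_combination w * hw3
  have i3 : w⁻¹ = w ^ 2 := by
    field_simp; exact hw3.symm
  have c1 := qPochInf_cube hq hw2 (nome τ)
  have c2 := qPochInf_cube hq4 hw2 (-nome τ ^ 4)
  rw [qPochInf_neg_nome hτ four_ne_zero, show (-nome τ ^ 4) ^ 3 = -nome τ ^ 12 by ring, ← pow_mul,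
    qPochInf_neg_nome hτ (m := 12) (by norm_num)] at c2
  norm_num only at c2
  have E1 : eulerProd 1 τ = qPochInf (nome τ) (nome τ) := by rw [eulerProd, pow_one]
  have c1' : eulerProd 1 τ * (qPochInf (nome τ * w ^ 2) (nome τ) * qPochInf (nome τ * w) (nome τ)) =
      eulerProd 3 τ := by
    rw [E1, eulerProd, ← c1]; ring
  rw [hs2, hc4, theta1_eq_prod hτ, theta2_four_mul_eq_prod hτ, ← hw, e2, i1, i2, i3, hs2, hc4,
    nomePow_half, c1'] at h2
  have n1 := nomePow_ne_zero τ (1 / 8)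
  have n2 := nomePow_ne_zero τ (3 / 8)
  have n3 := eulerProd_ne_zero hτ one_ne_zero
  have n4 := eulerProd_ne_zero hτ four_ne_zero
  have n5 := eulerProd_ne_zero hτ (m := 8) (by norm_num)
  have n6 := eulerProd_ne_zero hτ (m := 12) (by norm_num)
  have n7 := eulerProd_ne_zero hτ (m := 24) (by norm_num)
  have c2' : qPochInf (-nome τ ^ 4 * w) (nome τ ^ 4) * qPochInf (-nome τ ^ 4 * w ^ 2) (nome τ ^ 4) =
      eulerProd 24 τ / eulerProd 12 τ * (eulerProd 4 τ / eulerProd 8 τ) := by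
    rw [← c2]; field_simp
  rw [c2'] at h2
  generalize ((√3 / 2 : ℝ) : ℂ) = r at *
  -- At z = π/3, with r = √3/2, sin 2z / cos 4z = -2r and every series term carries r, so -2r is a
  -- common factor.
  refine mul_left_cancel₀ (mul_ne_zero (neg_ne_zero.mpr two_ne_zero) hr3) ?_
  refine Eq.trans ?_ (h2.trans ?_)
  · ring
  · field_simp

/-! ### The limit z → 0 -/

theorem abs_sin_nat_mul_le (n : ℕ) (t : ℝ) : |Real.sin (n * t)| ≤ n * |Real.sin t| := by
  induction n with
  | zero => simp
  | succ n ih =>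
    push_cast
    rw [add_mul, one_mul, Real.sin_add, add_mul, one_mul]
    refine (abs_add_le _ _).trans (add_le_add ?_ ?_)
    · rw [abs_mul]
      exact (mul_le_of_le_one_right (abs_nonneg _) (Real.abs_cos_le_one _)).trans ih
    · rw [abs_mul]
      exact mul_le_of_le_one_left (abs_nonneg _) (Real.abs_cos_le_one _)

theorem tendsto_sin_mul_div (c : ℝ) :
    Tendsto (fun t : ℝ => Real.sin (c * t) / t) (𝓝[≠] 0) (𝓝 c) := by
  have h : HasDerivAt (fun t : ℝ => Real.sin (c * t)) c 0 := by
    have := ((hasDerivAt_id (0 : ℝ)).const_mul c).sin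
    simpa [Function.comp_def] using this
  refine (hasDerivAt_iff_tendsto_slope_zero.mp h).congr fun t => ?_
  simp [div_eq_inv_mul]

theorem tendsto_sin_div_sin (n : ℕ) :
    Tendsto (fun t : ℝ => Complex.sin (2 * (n : ℂ) * t) / Complex.sin (2 * t)) (𝓝[≠] 0) (𝓝 n) := by
  have h := (tendsto_sin_mul_div (2 * n)).div (tendsto_sin_mul_div 2) two_ne_zero
  rw [mul_div_cancel_left₀ _ (two_ne_zero' ℝ)] at h
  have h' := (continuous_ofReal.tendsto _).comp h
  rw [ofReal_natCast] at h'
  refine h'.congr' ?_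
  filter_upwards [self_mem_nhdsWithin] with t ht
  have ht' : t ≠ 0 := ht
  simp only [Function.comp, Pi.div_apply]
  rw [div_div_div_cancel_right₀ ht']
  push_cast
  rfl

/-- Supplies a majorant uniform in t; zeros of sin 2t are harmless because division by zero gives 0.
-/
theorem norm_sin_div_sin_le (n : ℕ) (t : ℝ) :
    ‖Complex.sin (2 * (n : ℂ) * t) / Complex.sin (2 * t)‖ ≤ n := by
  have h1 : Complex.sin (2 * (n : ℂ) * t) = ((Real.sin (n * (2 * t)) : ℝ) : ℂ) := by
    push_cast; ring_nf
  have h2 : Complex.sin (2 * (t : ℂ)) = ((Real.sin (2 * t) : ℝ) : ℂ) := by push_cast; rfl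
  rw [h1, h2, norm_div, norm_real, norm_real, Real.norm_eq_abs, Real.norm_eq_abs]
  exact div_le_of_le_mul₀ (abs_nonneg _) (Nat.cast_nonneg _) (abs_sin_nat_mul_le n _)

theorem norm_pow_div_one_sub_le {q : ℂ} (hq : ‖q‖ < 1) {n : ℕ} (hn : n ≠ 0) :
    ‖q ^ n / (1 - q ^ n)‖ ≤ (1 - ‖q‖)⁻¹ * ‖q‖ ^ n := by
  have h0 : 0 < 1 - ‖q‖ := by linarith
  have h1 : 1 - ‖q‖ ≤ ‖1 - q ^ n‖ := by
    have h2 := norm_sub_norm_le 1 (q ^ n)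
    have h3 : ‖q ^ n‖ ≤ ‖q‖ := by
      rw [norm_pow]; exact pow_le_of_le_one (norm_nonneg _) hq.le hn
    rw [norm_one] at h2
    linarith
  rw [norm_div, norm_pow, div_eq_inv_mul]
  gcongr

theorem lambert_zero {τ : ℂ} (hτ : 0 < τ.im) :
    Summable (fun n : ℕ+ => (chi8 n : ℂ) *
        (((n : ℕ) : ℂ) * nome τ ^ (n : ℕ) / (1 - nome τ ^ (n : ℕ)))) ∧
      1 - 2 * ∑' n : ℕ+, (chi8 n : ℂ) *
          (((n : ℕ) : ℂ) * nome τ ^ (n : ℕ) / (1 - nome τ ^ (n : ℕ)))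
        = eulerProd 1 τ ^ 2 * eulerProd 2 τ * eulerProd 4 τ ^ 3 / eulerProd 8 τ ^ 2 := by
  have hq := norm_nome_lt_one hτ
  have hq4 : ‖nome τ ^ 4‖ < 1 := by rw [norm_pow]; exact pow_lt_one₀ (norm_nonneg _) hq four_ne_zero
  have hb : Summable fun n : ℕ+ => (1 - ‖nome τ‖)⁻¹ * (((n : ℕ) : ℝ) * ‖nome τ‖ ^ (n : ℕ)) := by
    refine Summable.mul_left _ ?_
    have := summable_pow_mul_geometric_of_norm_lt_one (R := ℝ) 1 (r := ‖nome τ‖) (by simpa using hq)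
    simp only [pow_one] at this
    exact this.comp_injective PNat.coe_injective
  have hle : ∀ n : ℕ+, ‖(chi8 n : ℂ) * (nome τ ^ (n : ℕ) / (1 - nome τ ^ (n : ℕ)))‖ ≤
      (1 - ‖nome τ‖)⁻¹ * ‖nome τ‖ ^ (n : ℕ) := fun n => by
    rw [norm_mul]
    exact (mul_le_of_le_one_left (norm_nonneg _) (norm_chi8_le _)).trans
      (norm_pow_div_one_sub_le hq n.ne_zero)
  have hform : ∀ n : ℕ+, (chi8 n : ℂ) * (((n : ℕ) : ℂ) * nome τ ^ (n : ℕ) / (1 - nome τ ^ (n : ℕ))) =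
      (chi8 n : ℂ) * (nome τ ^ (n : ℕ) / (1 - nome τ ^ (n : ℕ))) * ((n : ℕ) : ℂ) := fun n => by ring
  have hC : 0 ≤ (1 - ‖nome τ‖)⁻¹ := inv_nonneg.mpr (by linarith)
  simp only [hform]
  have hbound : ∀ (n : ℕ+) (w : ℂ), ‖w‖ ≤ (n : ℕ) →
      ‖(chi8 n : ℂ) * (nome τ ^ (n : ℕ) / (1 - nome τ ^ (n : ℕ))) * w‖ ≤
        (1 - ‖nome τ‖)⁻¹ * (((n : ℕ) : ℝ) * ‖nome τ‖ ^ (n : ℕ)) := fun n w hw => by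
    rw [norm_mul]
    refine (mul_le_mul (hle n) hw (norm_nonneg _) (by positivity)).trans_eq ?_
    ring
  refine ⟨.of_norm_bounded hb fun n => hbound n _ (by simp), ?_⟩
  have hid : Tendsto (fun t : ℝ => (t : ℂ)) (𝓝[≠] 0) (𝓝 0) := by
    have h : Tendsto (fun t : ℝ => (t : ℂ)) (𝓝 0) (𝓝 0) := by
      simpa using continuous_ofReal.tendsto 0
    exact h.mono_left nhdsWithin_le_nhds
  have hcos : Tendsto (fun t : ℝ => Complex.cos (4 * t)) (𝓝[≠] 0) (𝓝 1) := by
    have := (Complex.continuous_cos.tendsto _).comp (hid.const_mul 4)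
    simpa [Function.comp_def] using this
  have hexp : ∀ c : ℂ, Tendsto (fun t : ℝ => cexp (c * t * I) ^ 2) (𝓝[≠] 0) (𝓝 1) := fun c => by
    have := ((Complex.continuous_exp.tendsto _).comp ((hid.const_mul c).mul_const I)).pow 2
    simpa [Function.comp_def] using this
  have hsin : ∀ᶠ t : ℝ in 𝓝[≠] 0, Complex.sin (2 * t) ≠ 0 := by
    filter_upwards [(tendsto_sin_mul_div 2).eventually_ne two_ne_zero] with t ht h
    apply ht
    have h2 : ((Real.sin (2 * t) : ℝ) : ℂ) = 0 := by push_cast; exact h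
    rw [ofReal_eq_zero.mp h2, zero_div]
  have hL : Tendsto (fun t : ℝ => 1 / Complex.cos (4 * t) - 2 * ∑' n : ℕ+, (chi8 n : ℂ) *
      (nome τ ^ (n : ℕ) / (1 - nome τ ^ (n : ℕ))) *
        (Complex.sin (2 * ((n : ℕ) : ℂ) * t) / Complex.sin (2 * t))) (𝓝[≠] 0)
      (𝓝 (1 / 1 - 2 * ∑' n : ℕ+, (chi8 n : ℂ) *
        (nome τ ^ (n : ℕ) / (1 - nome τ ^ (n : ℕ))) * ((n : ℕ) : ℂ))) := by
    refine (tendsto_const_nhds.div hcos one_ne_zero).sub (Tendsto.const_mul _ ?_)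
    exact tendsto_tsum_of_dominated_convergence hb
      (fun n => (tendsto_sin_div_sin n).const_mul _)
      (Eventually.of_forall fun t n => hbound n _ (norm_sin_div_sin_le n t))
  have g1 := (tendsto_qPochInf hq ((hexp 2).const_mul (nome τ))).mul
    (tendsto_qPochInf hq (((hexp 2).inv₀ one_ne_zero).const_mul (nome τ)))
  have g2 := (tendsto_qPochInf hq4 ((hexp 4).const_mul (-nome τ ^ 4))).mul
    (tendsto_qPochInf hq4 (((hexp 4).inv₀ one_ne_zero).const_mul (-nome τ ^ 4)))
  have n1 := nomePow_ne_zero τ (1 / 8)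
  have n2 := nomePow_ne_zero τ (3 / 8)
  have n3 := eulerProd_ne_zero hτ one_ne_zero
  have n4 := eulerProd_ne_zero hτ four_ne_zero
  have n5 := eulerProd_ne_zero hτ (m := 8) (by norm_num)
  have p4 := qPochInf_neg_nome hτ four_ne_zero
  rw [show 2 * 4 = 8 by norm_num] at p4
  have E1 : eulerProd 1 τ = qPochInf (nome τ) (nome τ) := by rw [eulerProd, pow_one]
  simp only [inv_one, mul_one, ← E1] at g1
  simp only [inv_one, mul_one, p4] at g2
  have hR := ((g1.const_mul (2 * nomePow τ (1 / 8) * eulerProd 1 τ)).div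
    ((hcos.const_mul (2 * nomePow τ (1 / 2))).mul (g2.const_mul (eulerProd 4 τ)))
      (mul_ne_zero (mul_ne_zero (mul_ne_zero two_ne_zero (nomePow_ne_zero _ _)) one_ne_zero)
        (mul_ne_zero n4 (mul_ne_zero (div_ne_zero n5 n4) (div_ne_zero n5 n4))))).const_mul
      (nomePow τ (3 / 8) * (eulerProd 4 τ ^ 2 * eulerProd 2 τ / eulerProd 1 τ))
  -- For small real t ≠ 0 the strip identity is divided by sin 2t, which is an explicit factor of
  -- the product for θ₁(2t); both sides then have limits.
  have heq := tendsto_nhds_unique (hL.congr' ?_) hR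
  · rw [nomePow_half] at heq
    refine Eq.trans ?_ (heq.trans ?_)
    · ring
    · field_simp
  · filter_upwards [hsin, hcos.eventually_ne one_ne_zero] with t hs hc
    obtain ⟨-, -, h⟩ := lambert_identity hτ (z := (t : ℂ))
      (by rw [ofReal_im, abs_zero]; exact mul_pos Real.pi_pos hτ) hc
    rw [theta1_eq_prod hτ, theta2_four_mul_eq_prod hτ] at h
    refine mul_left_cancel₀ hs (Eq.trans ?_ (h.trans ?_))
    · have e : ∀ n : ℕ+, (chi8 n : ℂ) * (nome τ ^ (n : ℕ) / (1 - nome τ ^ (n : ℕ))) *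
          (Complex.sin (2 * ((n : ℕ) : ℂ) * t) / Complex.sin (2 * t)) =
          ((chi8 n : ℂ) * (nome τ ^ (n : ℕ) / (1 - nome τ ^ (n : ℕ))) *
            Complex.sin (2 * ((n : ℕ) : ℂ) * t)) / Complex.sin (2 * t) := fun n => by ring
      simp only [e, tsum_div_const]
      field_simp
    · simp only [Pi.div_apply]
      ring

end EvenCharacterLambert

open EvenCharacterLambert in
theorem mainTheorem9 (τ : ℂ) (hτ : 0 < τ.im) :
    -- the identity, on the whole strip where the series converges, off the poles
    (∀ z : ℂ, |z.im| < Real.pi * τ.im → Complex.cos (4 * z) ≠ 0 →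
      theta2 (4 * z) (4 * τ) ≠ 0 ∧
      Summable (fun n : ℕ+ =>
        (chi8 n : ℂ) * (nome τ ^ (n : ℕ) / (1 - nome τ ^ (n : ℕ))) * Complex.sin (2 * ((n : ℕ) : ℂ) * z)) ∧
      Complex.sin (2 * z) / Complex.cos (4 * z)
          - 2 * ∑' n : ℕ+, (chi8 n : ℂ) * (nome τ ^ (n : ℕ) / (1 - nome τ ^ (n : ℕ)))
              * Complex.sin (2 * ((n : ℕ) : ℂ) * z)
        = nomePow τ (3 / 8) * (eulerProd 4 τ ^ 2 * eulerProd 2 τ / eulerProd 1 τ)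
            * (theta1 (2 * z) τ / theta2 (4 * z) (4 * τ))) ∧
    -- the limiting case `z → 0`
    (Summable (fun n : ℕ+ => (chi8 n : ℂ) * (((n : ℕ) : ℂ) * nome τ ^ (n : ℕ) / (1 - nome τ ^ (n : ℕ)))) ∧
      1 - 2 * ∑' n : ℕ+, (chi8 n : ℂ) * (((n : ℕ) : ℂ) * nome τ ^ (n : ℕ) / (1 - nome τ ^ (n : ℕ)))
        = eulerProd 1 τ ^ 2 * eulerProd 2 τ * eulerProd 4 τ ^ 3 / eulerProd 8 τ ^ 2) ∧
    -- the case `z = π / 3`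
    (Summable (fun n : ℕ+ => (kronecker (-24) n : ℂ) * (nome τ ^ (n : ℕ) / (1 - nome τ ^ (n : ℕ)))) ∧
      1 + ∑' n : ℕ+, (kronecker (-24) n : ℂ) * (nome τ ^ (n : ℕ) / (1 - nome τ ^ (n : ℕ)))
        = eulerProd 2 τ * eulerProd 3 τ * eulerProd 8 τ * eulerProd 12 τ / (eulerProd 1 τ * eulerProd 24 τ)) ∧
    -- the case `z = π / 4`
    (Summable (fun n : ℕ+ => (kronecker (-32) n : ℂ) * (nome τ ^ (n : ℕ) / (1 - nome τ ^ (n : ℕ)))) ∧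
      1 + 2 * ∑' n : ℕ+, (kronecker (-32) n : ℂ) * (nome τ ^ (n : ℕ) / (1 - nome τ ^ (n : ℕ)))
        = eulerProd 2 τ ^ 3 * eulerProd 4 τ ^ 3 / (eulerProd 1 τ ^ 2 * eulerProd 8 τ ^ 2)) := by
  exact ⟨fun z hz hc => lambert_identity hτ hz hc, lambert_zero hτ, lambert_pi_div_three hτ,
    lambert_pi_div_four hτ⟩
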